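/- **Definitions.** For an integer $k\ge 1$ let $[\mathbb N]^k$ be the set of $k$-element subsets of $\mathbb N$, each listed increasingly as $\bar n=(n_1<\dots<n_k)$. Two distinct $\bar n,\bar m\in[\mathbb N]^k$ are adjacent if $n_1\le m_1\le n_2\le\dots\le n_k\le m_k$ or $m_1\le n_1\le m_2\le\dots\le m_k\le n_k$, and $d^k_{\mathbb K}$ is the resulting shortest path distance on $[\mathbb N]^k$ (the Kalton interlaced graphs). For a map $f:M\to N$ between metric spaces and $t\ge 0$ put $\rho_f(t)=\inf\{d_N(f(x),f(y)): d_M(x,y)\ge t\}$ and $\omega_f(t)=\sup\{d_N(f(x),f(y)): d_M(x,y)\le t\}$, with $\inf\emptyset=\infty$ and $\sup\emptyset=0$. A family $(M_i)_{i\in I}$ of metric spaces *equi-coarsely embeds* into $N$ if there are functions $\rho,\omega:[0,\infty)\to[0,\infty)$ with $\lim_{t\to\infty}\rho(t)=\infty$ and maps $f_i:M_i\to N$ such that $\rho(t)\le\rho_{f_i}(t)$ and $\omega_{f_i}(t)\le\omega(t)$ for all $i\in I$ and $t\ge 0$. A Banach space $X$ has *Kalton's property $\mathcal Q$* if there is $C\ge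 1$ such that for every $k\ge 1$ and every Lipschitz map $f:([\mathbb N]^k,d^k_{\mathbb K})\to X$ there is an infinite set $A\subset\mathbb N$ with $\|f(\bar n)-f(\bar m)\|\le C\,\omega_f(1)$ for all $k$-element subsets $\bar n,\bar m$ of $A$. For $p\in(1,\infty)$ the *James space* $J_p$ is the real Banach space of all real sequences $x=(x(n))_{n\in\mathbb N}$ of finite $p$-variation with $\lim_n x(n)=0$, normed by $$\|x\|_{J_p}=\sup\Big\{\Big(\sum_{i=1}^{k-1}|x(p_{i+1})-x(p_i)|^p\Big)^{1/p} : p_1<p_2<\dots<p_k\Big\}.$$ $J_p^*$ is its dual with the operator norm, and $J=J_2$. **Corollary 5.3 (James).** Let $p\in(1,\infty)$. The family $([\mathbb N]^k,d^k_{\mathbb K})_{k\ge 1}$ does not equi-coarsely embed into $J_p$, nor does it equi-coarsely embed into $J_p^*$. On the other hand, neither $J$ nor $J^*$ has property $\mathcal Q$. -/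

import Mathlib

open Filter Topology
open scoped NNReal ENNReal

/-! ### Coarse embeddings -/

section Coarse

variable {M : Type*} {N : Type*} [MetricSpace M] [MetricSpace N]

/-- The compression modulus `ρ_f(t) = inf {d(f x, f y) : d(x, y) ≥ t}`, with `inf ∅ = ∞`. -/
noncomputable def compressionModulus (f : M → N) (t : ℝ≥0) : ℝ≥0∞ :=
  ⨅ (x : M) (y : M) (_ : (t : ℝ) ≤ dist x y), edist (f x) (f y)

/-- The expansion modulus `ω_f(t) = sup {d(f x, f y) : d(x, y) ≤ t}`, with `sup ∅ = 0`. -/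
noncomputable def expansionModulus (f : M → N) (t : ℝ≥0) : ℝ≥0∞ :=
  ⨆ (x : M) (y : M) (_ : dist x y ≤ (t : ℝ)), edist (f x) (f y)

end Coarse

/-- The family of metric spaces `(M i)` equi-coarsely embeds into `N`. The bounding functions
`ρ, ω : [0,∞) → [0,∞)` do not depend on `i`. -/
def EquiCoarselyEmbeds {ι : Type*} (M : ι → Type*) [∀ i, MetricSpace (M i)]
    (N : Type*) [MetricSpace N] : Prop :=
  ∃ (ρ ω : ℝ≥0 → ℝ≥0) (f : ∀ i, M i → N),
    Tendsto ρ atTop atTop ∧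
    ∀ (i : ι) (t : ℝ≥0),
      (ρ t : ℝ≥0∞) ≤ compressionModulus (f i) t ∧ expansionModulus (f i) t ≤ (ω t : ℝ≥0∞)

/-! ### The Kalton interlaced graphs -/

/-- `[ℕ]^k`: the `k`-element subsets of `ℕ`, each listed in increasing order. -/
def KaltonVertex (k : ℕ) : Type := Fin k ↪o ℕ

instance (k : ℕ) : FunLike (KaltonVertex k) (Fin k) ℕ :=
  inferInstanceAs (FunLike (Fin k ↪o ℕ) (Fin k) ℕ)

/-- `n₁ ≤ m₁ ≤ n₂ ≤ m₂ ≤ ⋯ ≤ n_k ≤ m_k`. -/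
def Interlaced {k : ℕ} (n m : KaltonVertex k) : Prop :=
  (∀ i, n i ≤ m i) ∧ ∀ i j : Fin k, (i : ℕ) + 1 = (j : ℕ) → m i ≤ n j

/-- The Kalton interlaced graph on `[ℕ]^k`. -/
def kaltonGraph (k : ℕ) : SimpleGraph (KaltonVertex k) where
  Adj n m := n ≠ m ∧ (Interlaced n m ∨ Interlaced m n)
  symm := ⟨fun _ _ h => ⟨h.1.symm, h.2.symm⟩⟩
  loopless := ⟨fun _ h => h.1 rfl⟩

/-- The vertex formed by `k` consecutive terms of a strictly increasing sequence. -/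
def kaltonWindow (k : ℕ) (c : ℕ → ℕ) (hc : StrictMono c) (j : ℕ) : KaltonVertex k :=
  OrderEmbedding.ofStrictMono (fun i : Fin k => c (j + i))
    (fun _ _ h => hc (Nat.add_lt_add_left h j))

theorem kaltonWindow_apply (k : ℕ) (c : ℕ → ℕ) (hc : StrictMono c) (j : ℕ) (i : Fin k) :
    kaltonWindow k c hc j i = c (j + i) := rfl

theorem kaltonWindow_reachable (k : ℕ) (c : ℕ → ℕ) (hc : StrictMono c) (j : ℕ) :
    (kaltonGraph k).Reachable (kaltonWindow k c hc 0) (kaltonWindow k c hc j) := by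
  induction j with
  | zero => exact SimpleGraph.Reachable.refl _
  | succ j ih =>
    refine ih.trans ?_
    by_cases h : kaltonWindow k c hc j = kaltonWindow k c hc (j + 1)
    · rw [h]
    · refine SimpleGraph.Adj.reachable ⟨h, Or.inl ⟨fun i => ?_, fun a b hab => ?_⟩⟩
      · simp only [kaltonWindow_apply]
        exact hc.monotone (by omega)
      · simp only [kaltonWindow_apply]
        exact hc.monotone (by omega)

/-- Every vertex is joined by a path to every vertex `(B + k, B + k + 1, …, B + 2k - 1)` with `B`
large. -/
theorem kaltonGraph_reachable_far {k : ℕ} (n : KaltonVertex k) (B : ℕ) (hB : ∀ i, n i < B)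
    (hs : StrictMono fun i : ℕ => B + i) :
    (kaltonGraph k).Reachable n (kaltonWindow k (fun i => B + i) hs k) := by
  have hn : StrictMono n := OrderEmbedding.strictMono (show Fin k ↪o ℕ from n)
  have hc : StrictMono (fun i : ℕ => if h : i < k then n ⟨i, h⟩ else B + i) := by
    intro a b hab
    by_cases hb : b < k
    · have ha : a < k := hab.trans hb
      simp only [ha, hb, dif_pos]
      exact hn hab
    · by_cases ha : a < k
      · simp only [ha, hb, dif_pos, dif_neg, not_false_eq_true]
        have := hB ⟨a, ha⟩
        omega
      · simp only [ha, hb, dif_neg, not_false_eq_true]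
        omega
  have h := kaltonWindow_reachable k _ hc k
  have h0 : kaltonWindow k _ hc 0 = n := by
    apply DFunLike.ext
    intro i
    simp [kaltonWindow_apply]
  have h1 : kaltonWindow k _ hc k = kaltonWindow k (fun i => B + i) hs k := by
    apply DFunLike.ext
    intro i
    simp [kaltonWindow_apply]
  rwa [h0, h1] at h

theorem kaltonGraph_connected (k : ℕ) : (kaltonGraph k).Connected := by
  have : Nonempty (KaltonVertex k) := ⟨kaltonWindow k id strictMono_id 0⟩
  refine SimpleGraph.Connected.mk fun n m => ?_
  have hs : ∀ B : ℕ, StrictMono fun i : ℕ => B + i := fun B a b h => Nat.add_lt_add_left h B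
  let B := (∑ i, n i) + (∑ i, m i) + 1
  have hn : ∀ i, n i < B := fun i => by
    have := Finset.single_le_sum (f := fun i => n i) (fun _ _ => Nat.zero_le _)
      (Finset.mem_univ i)
    simp only [B]; omega
  have hm : ∀ i, m i < B := fun i => by
    have := Finset.single_le_sum (f := fun i => m i) (fun _ _ => Nat.zero_le _)
      (Finset.mem_univ i)
    simp only [B]; omega
  exact (kaltonGraph_reachable_far n B hn (hs B)).trans
    (kaltonGraph_reachable_far m B hm (hs B)).symm

/-- `[ℕ]^k` with the shortest path distance `d_𝕂^k` of the Kalton interlaced graph. -/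
noncomputable instance (k : ℕ) : MetricSpace (KaltonVertex k) where
  dist n m := ((kaltonGraph k).dist n m : ℝ)
  dist_self n := by simp
  dist_comm n m := by rw [SimpleGraph.dist_comm]
  dist_triangle a b c := by exact_mod_cast (kaltonGraph_connected k).dist_triangle
  eq_of_dist_eq_zero {a b} h := by
    have h' : (kaltonGraph k).dist a b = 0 := by exact_mod_cast h
    exact (kaltonGraph_connected k).dist_eq_zero_iff.mp h'

/-- Kalton's property `𝒬` of a normed space `X`. -/
def PropertyQ (X : Type*) [NormedAddCommGroup X] : Prop :=
  ∃ C : ℝ≥0, 1 ≤ C ∧ ∀ (k : ℕ+) (f : KaltonVertex k → X),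
    (∃ L : ℝ≥0, LipschitzWith L f) →
      ∃ A : Set ℕ, A.Infinite ∧
        ∀ n m : KaltonVertex k, (∀ i, n i ∈ A) → (∀ i, m i ∈ A) →
          ‖f n - f m‖ₑ ≤ (C : ℝ≥0∞) * expansionModulus f 1

/-! ### The James spaces -/

/-- `(∑_{i < n} |x(u_{i+1}) - x(u_i)|^p)^{1/p}`, for a number `n` of increments and a strictly
increasing sequence `u` of indices (of which only `u_0 < ⋯ < u_n` matter). -/
noncomputable def jamesSum (p : ℝ) (x : ℕ → ℝ) (a : ℕ × {u : ℕ → ℕ // StrictMono u}) : ℝ :=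
  (∑ i ∈ Finset.range a.1, |x (a.2.1 (i + 1)) - x (a.2.1 i)| ^ p) ^ (1 / p)

/-- `x` has finite `p`-variation. -/
def HasFinitePVariation (p : ℝ) (x : ℕ → ℝ) : Prop :=
  BddAbove (Set.range (jamesSum p x))

theorem jamesSum_nonneg (p : ℝ) (x : ℕ → ℝ) (a) : 0 ≤ jamesSum p x a :=
  Real.rpow_nonneg (Finset.sum_nonneg fun _ _ => Real.rpow_nonneg (abs_nonneg _) _) _

theorem jamesSum_add_le (p : ℝ) (hp : 1 < p) (x y : ℕ → ℝ) (a) :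
    jamesSum p (x + y) a ≤ jamesSum p x a + jamesSum p y a := by
  have h := Real.Lp_add_le (Finset.range a.1)
    (fun i => x (a.2.1 (i + 1)) - x (a.2.1 i)) (fun i => y (a.2.1 (i + 1)) - y (a.2.1 i)) hp.le
  refine le_trans (le_of_eq ?_) h
  unfold jamesSum
  congr 1
  refine Finset.sum_congr rfl fun i _ => ?_
  congr 2
  simp only [Pi.add_apply]
  ring

theorem jamesSum_smul (p : ℝ) (hp : 1 < p) (c : ℝ) (x : ℕ → ℝ) (a) :
    jamesSum p (c • x) a = |c| * jamesSum p x a := by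
  have hp0 : p ≠ 0 := by linarith
  unfold jamesSum
  have h : ∀ i, |(c • x) (a.2.1 (i + 1)) - (c • x) (a.2.1 i)| ^ p
      = |c| ^ p * |x (a.2.1 (i + 1)) - x (a.2.1 i)| ^ p := fun i => by
    rw [← Real.mul_rpow (abs_nonneg _) (abs_nonneg _), ← abs_mul]
    simp only [Pi.smul_apply, smul_eq_mul]
    congr 2
    ring
  simp only [h]
  rw [← Finset.mul_sum, Real.mul_rpow (Real.rpow_nonneg (abs_nonneg _) _)
    (Finset.sum_nonneg fun _ _ => Real.rpow_nonneg (abs_nonneg _) _), ← Real.rpow_mul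
    (abs_nonneg _), mul_one_div_cancel hp0, Real.rpow_one]

theorem jamesSum_zero (p : ℝ) (hp : 1 < p) (a) : jamesSum p 0 a = 0 := by
  have := jamesSum_smul p hp 0 0 a
  simpa using this

/-- The vector space of all real sequences that have finite `p`-variation and tend to `0`. -/
def jamesSubmodule (p : ℝ) [hp : Fact (1 < p)] : Submodule ℝ (ℕ → ℝ) where
  carrier := {x | HasFinitePVariation p x ∧ Tendsto x atTop (𝓝 0)}
  zero_mem' := by
    refine ⟨⟨0, ?_⟩, tendsto_const_nhds⟩
    rintro _ ⟨a, rfl⟩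
    exact (jamesSum_zero p hp.out a).le
  add_mem' := by
    rintro x y ⟨⟨A, hA⟩, hx⟩ ⟨⟨B, hB⟩, hy⟩
    refine ⟨⟨A + B, ?_⟩, ?_⟩
    · rintro _ ⟨a, rfl⟩
      exact (jamesSum_add_le p hp.out x y a).trans (add_le_add (hA ⟨a, rfl⟩) (hB ⟨a, rfl⟩))
    · have h := hx.add hy
      rw [add_zero] at h
      exact h
  smul_mem' := by
    rintro c x ⟨⟨A, hA⟩, hx⟩
    refine ⟨⟨|c| * A, ?_⟩, ?_⟩
    · rintro _ ⟨a, rfl⟩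
      rw [jamesSum_smul p hp.out]
      exact mul_le_mul_of_nonneg_left (hA ⟨a, rfl⟩) (abs_nonneg c)
    · have h := hx.const_smul c
      rw [smul_zero] at h
      exact h

/-- The James space `J_p`, for `1 < p < ∞`. It is a type of its own so that it carries only the
topology of the James norm, not that of pointwise convergence. -/
def JamesSpace (p : ℝ) [Fact (1 < p)] : Type := jamesSubmodule p

namespace JamesSpace

variable {p : ℝ} [hp : Fact (1 < p)]

noncomputable instance : AddCommGroup (JamesSpace p) :=
  inferInstanceAs (AddCommGroup (jamesSubmodule p))

noncomputable instance : Module ℝ (JamesSpace p) :=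
  inferInstanceAs (Module ℝ (jamesSubmodule p))

/-- The sequence underlying an element of `J_p`. -/
def seq (x : JamesSpace p) : ℕ → ℝ := Subtype.val x

/-- `‖x‖ = sup (∑_{i=1}^{k-1} |x(p_{i+1}) - x(p_i)|^p)^{1/p}` over all `p_1 < ⋯ < p_k`. -/
noncomputable instance : Norm (JamesSpace p) where
  norm x := ⨆ a, jamesSum p x.seq a

theorem norm_def (x : JamesSpace p) : ‖x‖ = ⨆ a, jamesSum p x.seq a := rfl

theorem seq_add (x y : JamesSpace p) : (x + y).seq = x.seq + y.seq := rfl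

theorem seq_smul (c : ℝ) (x : JamesSpace p) : (c • x).seq = c • x.seq := rfl

theorem seq_zero : (0 : JamesSpace p).seq = 0 := rfl

theorem seq_injective : Function.Injective (seq : JamesSpace p → ℕ → ℝ) :=
  Subtype.val_injective

theorem jamesSum_le_norm (x : JamesSpace p) (a) : jamesSum p x.seq a ≤ ‖x‖ :=
  le_ciSup (f := jamesSum p x.seq) (Subtype.property x).1 a

instance : Nonempty (ℕ × {u : ℕ → ℕ // StrictMono u}) := ⟨(0, ⟨id, strictMono_id⟩)⟩

theorem eq_zero_of_norm_eq_zero (x : JamesSpace p) (h : ‖x‖ = 0) : x = 0 := by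
  have hp0 : p ≠ 0 := by have := hp.out; linarith
  have hstep : ∀ n, x.seq (n + 1) = x.seq n := by
    intro n
    have h1 := jamesSum_le_norm x (1, ⟨fun i => n + i, fun a b hab => Nat.add_lt_add_left hab n⟩)
    rw [h] at h1
    simp only [jamesSum, Finset.sum_range_one, zero_add, add_zero] at h1
    rw [← Real.rpow_mul (abs_nonneg _), mul_one_div_cancel hp0, Real.rpow_one] at h1
    exact sub_eq_zero.mp (abs_nonpos_iff.mp h1)
  have hconst : ∀ n, x.seq n = x.seq 0 := by
    intro n
    induction n with
    | zero => rfl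
    | succ n ih => rw [hstep, ih]
  have hlim : Tendsto x.seq atTop (𝓝 0) := (Subtype.property x).2
  have h0 : x.seq 0 = 0 := by
    have h2 : Tendsto x.seq atTop (𝓝 (x.seq 0)) :=
      tendsto_const_nhds.congr fun n => (hconst n).symm
    exact tendsto_nhds_unique h2 hlim
  apply seq_injective
  funext n
  rw [hconst n, h0, seq_zero, Pi.zero_apply]

theorem normedSpaceCore : NormedSpace.Core ℝ (JamesSpace p) where
  norm_nonneg x := Real.iSup_nonneg fun a => jamesSum_nonneg p x.seq a
  norm_smul c x := by
    rw [norm_def, norm_def, seq_smul, Real.norm_eq_abs, Real.mul_iSup_of_nonneg (abs_nonneg c)]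
    simp only [jamesSum_smul p hp.out]
  norm_triangle x y := by
    rw [norm_def (x + y), seq_add]
    exact ciSup_le fun a => (jamesSum_add_le p hp.out _ _ a).trans
      (add_le_add (jamesSum_le_norm x a) (jamesSum_le_norm y a))
  norm_eq_zero_iff x := by
    refine ⟨eq_zero_of_norm_eq_zero x, ?_⟩
    rintro rfl
    rw [norm_def, seq_zero]
    simp only [jamesSum_zero p hp.out, ciSup_const]

noncomputable instance : NormedAddCommGroup (JamesSpace p) :=
  NormedAddCommGroup.ofCore normedSpaceCore

noncomputable instance : NormedSpace ℝ (JamesSpace p) :=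
  NormedSpace.ofCore normedSpaceCore

end JamesSpace

instance fact_one_lt_two_real : Fact ((1 : ℝ) < 2) := ⟨one_lt_two⟩

/-! Both J_p and its dual carry a basis of the kind recorded in `JamesBasis`: successive blocks
satisfy a lower r-estimate always, and an upper r-estimate once their coefficient sums vanish. For
J_p this is the summing basis with r = p (`JamesSpace.summingBasis`); for the dual it is the basis
of evaluations with r the conjugate exponent (`JamesSpace.nonempty_jamesBasis_dual`).

Let f be a bounded map from the k-th graph into such a space, with increments at most L along edges.
Iterated ultrafilter limits give, along a subsequence, f ≈ w₀ + ∑ b_j with successive blocks b_j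
whose totals are close to numbers γ_j depending on the position j only
(`JamesBasis.exists_block_approximation`). Comparing a vertex with its shift by one, which is
interlaced with it and has disjoint blocks, the lower estimate bounds ∑ ‖b_j‖^r in terms of L. After
subtracting from each b_j a basis vector carrying its total, the upper estimate bounds the sum of
the corrected blocks.

What is left is ∑ γ_j e_{n_j}, which may be large but cancels between two vertices wherever they
agree. If k is large, pigeonhole yields l consecutive positions along which the |γ_j| have bounded
sum. Moving a vertex at just these positions produces a vertex at distance at least l whose image
stays within a bound depending on L only (`JamesBasis.exists_far_pair`). Since l is arbitrary, the
compression modulus cannot tend to infinity.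

For property 𝒬, the maps summing indicators (in J) or evaluations (in J^*) over the entries of a
vertex have Lipschitz constant O(√k), while the images of n and m differ by at least k when n lies
entirely before m. Every infinite set contains such pairs. -/

/-- A sequence whose `r`-variation along subsequences is uniformly bounded is Cauchy. -/
theorem cauchySeq_of_sum_dist_rpow_le {α : Type*} [PseudoMetricSpace α] {s : ℕ → α} {r B : ℝ}
    (hr : 0 < r)
    (h : ∀ N : ℕ → ℕ, StrictMono N → ∀ M : ℕ,
      ∑ i ∈ Finset.range M, dist (s (N i)) (s (N (i + 1))) ^ r ≤ B) : CauchySeq s := by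
  by_contra hs
  rw [Metric.cauchySeq_iff'] at hs
  push Not at hs
  obtain ⟨ε, hε, hs⟩ := hs
  choose T hT hTε using hs
  have hlt : ∀ n, n < T n := fun n => by
    refine lt_of_le_of_ne (hT n) fun hn => ?_
    have := hTε n
    rw [← hn, dist_self] at this
    linarith
  let N : ℕ → ℕ := fun i => T^[i] 0
  have hN : ∀ i, N (i + 1) = T (N i) := fun i => Function.iterate_succ_apply' T i 0
  have hmono : StrictMono N := strictMono_nat_of_lt_succ fun i => by rw [hN]; exact hlt _
  obtain ⟨M, hM⟩ := exists_nat_gt (B / ε ^ r)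
  have hpos : 0 < ε ^ r := Real.rpow_pos_of_pos hε r
  have h1 := h N hmono M
  have h2 : (M : ℝ) * ε ^ r ≤ ∑ i ∈ Finset.range M, dist (s (N i)) (s (N (i + 1))) ^ r := by
    rw [← nsmul_eq_mul]
    have := Finset.card_nsmul_le_sum (Finset.range M)
      (fun i => dist (s (N i)) (s (N (i + 1))) ^ r) (ε ^ r) fun i _ => by
        refine Real.rpow_le_rpow hε.le ?_ hr.le
        rw [dist_comm, hN]
        exact hTε _
    simpa using this
  rw [div_lt_iff₀ hpos] at hM
  linarith

/-! ### Abstract James bases: projections and coordinatewise limits -/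

/-- A boundedly complete basis with a lower `r`-estimate on successive blocks and with an upper
`r`-estimate on those successive blocks that are annihilated by the sum-of-coefficients
functional `total`. -/
structure JamesBasis (W : Type*) [NormedAddCommGroup W] [NormedSpace ℝ W] (r : ℝ) where
  /-- The basis. -/
  vec : ℕ → W
  /-- The coordinate functionals. -/
  coord : ℕ → StrongDual ℝ W
  /-- The sum of the coefficients. -/
  total : StrongDual ℝ W
  /-- A constant for all the estimates. -/
  K : ℝ
  one_le_K : 1 ≤ K
  coord_vec : ∀ m n, coord m (vec n) = if m = n then 1 else 0
  total_vec : ∀ n, total (vec n) = 1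
  norm_vec_le : ∀ n, ‖vec n‖ ≤ K
  norm_total_le : ‖total‖ ≤ K
  norm_le : ∀ (x : W) (R : ℝ),
    (∀ n, ‖∑ m ∈ Finset.Ico 0 n, coord m x • vec m‖ ≤ R) → ‖x‖ ≤ R
  exists_limit : ∀ (F : ℕ → W) (R : ℝ), (∀ i, ‖F i‖ ≤ R) →
    ∃ x, ∀ m, Tendsto (fun i => coord m (F i)) (hyperfilter ℕ : Filter ℕ) (𝓝 (coord m x))
  lower : ∀ lo hi : ℕ → ℕ, (∀ j, lo j ≤ hi j) → (∀ j, hi j ≤ lo (j + 1)) → ∀ (x : W) (M : ℕ),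
    ∑ j ∈ Finset.range M, ‖∑ m ∈ Finset.Ico (lo j) (hi j), coord m x • vec m‖ ^ r
      ≤ (K * ‖x‖) ^ r
  upper : ∀ lo hi : ℕ → ℕ, (∀ j, lo j ≤ hi j) → (∀ j, hi j ≤ lo (j + 1)) →
    ∀ (z : ℕ → W) (M : ℕ),
      (∀ j < M, ∑ m ∈ Finset.Ico (lo j) (hi j), coord m (z j) • vec m = z j) →
      (∀ j < M, total (z j) = 0) →
      ‖∑ j ∈ Finset.range M, z j‖ ^ r ≤ K ^ r * ∑ j ∈ Finset.range M, ‖z j‖ ^ r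

namespace JamesBasis

variable {W : Type*} [NormedAddCommGroup W] [NormedSpace ℝ W] {r : ℝ} (B : JamesBasis W r)

/-- The projection onto the span of the basis vectors with index in `[lo, hi)`. -/
noncomputable def proj (lo hi : ℕ) : W →L[ℝ] W :=
  ∑ m ∈ Finset.Ico lo hi, (B.coord m).smulRight (B.vec m)

theorem proj_apply (lo hi : ℕ) (x : W) :
    B.proj lo hi x = ∑ m ∈ Finset.Ico lo hi, B.coord m x • B.vec m := by
  simp [proj]

theorem coord_proj (lo hi m : ℕ) (x : W) :
    B.coord m (B.proj lo hi x) = if m ∈ Finset.Ico lo hi then B.coord m x else 0 := by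
  simp only [proj_apply, map_sum, map_smul, B.coord_vec, smul_eq_mul, mul_ite, mul_one, mul_zero]
  rw [Finset.sum_ite_eq]

theorem proj_congr {lo hi : ℕ} {x y : W}
    (h : ∀ m ∈ Finset.Ico lo hi, B.coord m x = B.coord m y) :
    B.proj lo hi x = B.proj lo hi y := by
  rw [proj_apply, proj_apply]
  exact Finset.sum_congr rfl fun m hm => by rw [h m hm]

theorem proj_proj_self (lo hi : ℕ) (x : W) :
    B.proj lo hi (B.proj lo hi x) = B.proj lo hi x :=
  B.proj_congr fun m hm => by rw [coord_proj, if_pos hm]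

theorem proj_proj_of_disjoint {lo hi lo' hi' : ℕ} (h : hi ≤ lo' ∨ hi' ≤ lo) (x : W) :
    B.proj lo hi (B.proj lo' hi' x) = 0 := by
  rw [proj_apply]
  refine Finset.sum_eq_zero fun m hm => ?_
  rw [coord_proj, if_neg, zero_smul]
  simp only [Finset.mem_Ico] at hm ⊢
  omega

theorem proj_sub_proj {lo hi : ℕ} (h : lo ≤ hi) (x : W) :
    B.proj 0 hi x - B.proj 0 lo x = B.proj lo hi x := by
  simp only [proj_apply]
  rw [sub_eq_iff_eq_add', Finset.sum_Ico_consecutive _ (Nat.zero_le _) h]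

theorem proj_vec {lo hi m : ℕ} (hm : m ∈ Finset.Ico lo hi) :
    B.proj lo hi (B.vec m) = B.vec m := by
  simp only [proj_apply, B.coord_vec, ite_smul, one_smul, zero_smul]
  rw [Finset.sum_ite_eq', if_pos hm]

theorem K_pos : 0 < B.K := zero_lt_one.trans_le B.one_le_K

theorem abs_total_le (x : W) : |B.total x| ≤ B.K * ‖x‖ := by
  have := B.total.le_opNorm x
  rw [Real.norm_eq_abs] at this
  exact this.trans (mul_le_mul_of_nonneg_right B.norm_total_le (norm_nonneg _))

theorem norm_proj_le (hr : 0 < r) {lo hi : ℕ} (h : lo ≤ hi) (x : W) :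
    ‖B.proj lo hi x‖ ≤ B.K * ‖x‖ := by
  -- Only the block with index 0 counts; the later ones are empty padding.
  have := B.lower (fun j => if j = 0 then lo else hi) (fun _ => hi)
    (fun j => by split_ifs <;> omega) (fun j => by simp) x 1
  simp only [Finset.sum_range_one, if_true, ← proj_apply] at this
  exact (Real.rpow_le_rpow_iff (norm_nonneg _)
    (mul_nonneg B.K_pos.le (norm_nonneg _)) hr).mp this

/-- The lower estimate bounds the r-variation of the partial sums, so they are Cauchy. No
completeness of `W` is needed: `norm_le`, applied to the difference from x, identifies the limit. -/
theorem tendsto_proj (hr : 0 < r) (x : W) :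
    Tendsto (fun n => B.proj 0 n x) atTop (𝓝 x) := by
  have hc : CauchySeq fun n => B.proj 0 n x := by
    refine cauchySeq_of_sum_dist_rpow_le (B := (B.K * ‖x‖) ^ r) hr fun N hN M => ?_
    refine le_trans (le_of_eq (Finset.sum_congr rfl fun i _ => ?_))
      (B.lower N (fun i => N (i + 1)) (fun j => hN.monotone (Nat.le_succ j)) (fun j => le_rfl) x M)
    rw [dist_comm, dist_eq_norm, B.proj_sub_proj (hN.monotone (Nat.le_succ i)), proj_apply]
  rw [Metric.tendsto_atTop]
  intro ε hε
  obtain ⟨n₀, hn₀⟩ := Metric.cauchySeq_iff.mp hc (ε / 2) (half_pos hε)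
  refine ⟨n₀, fun n hn => ?_⟩
  rw [dist_comm, dist_eq_norm]
  refine lt_of_le_of_lt (B.norm_le _ (ε / 2) fun m => ?_) (half_lt_self hε)
  rw [← proj_apply, map_sub]
  rcases le_total n m with h | h
  · have h1 : B.proj 0 m (B.proj 0 n x) = B.proj 0 n x := by
      rw [proj_apply]
      conv_rhs => rw [proj_apply]
      rw [← Finset.sum_Ico_consecutive _ (Nat.zero_le n) h]
      rw [Finset.sum_eq_zero (s := Finset.Ico n m), add_zero]
      · exact Finset.sum_congr rfl fun i hi => by rw [coord_proj, if_pos hi]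
      · intro i hi
        rw [coord_proj, if_neg, zero_smul]
        simp only [Finset.mem_Ico] at hi ⊢
        omega
    rw [h1, ← dist_eq_norm]
    exact (hn₀ m (hn.trans h) n hn).le
  · have h1 : B.proj 0 m (B.proj 0 n x) = B.proj 0 m x := by
      refine B.proj_congr fun i hi => ?_
      rw [coord_proj, if_pos]
      simp only [Finset.mem_Ico] at hi ⊢
      omega
    rw [h1, sub_self, norm_zero]
    positivity

theorem tendsto_proj_of_coord {ι : Type*} {l : Filter ι} {F : ι → W} {x : W}
    (h : ∀ m, Tendsto (fun i => B.coord m (F i)) l (𝓝 (B.coord m x))) (lo hi : ℕ) :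
    Tendsto (fun i => B.proj lo hi (F i)) l (𝓝 (B.proj lo hi x)) := by
  simp only [proj_apply]
  exact tendsto_finsetSum _ fun m _ => (h m).smul_const _

theorem norm_le_of_tendsto_coord (hr : 0 < r) {F : ℕ → W} {x : W} {R : ℝ}
    (hF : ∀ i, ‖F i‖ ≤ R)
    (h : ∀ m, Tendsto (fun i => B.coord m (F i)) (hyperfilter ℕ : Filter ℕ)
      (𝓝 (B.coord m x))) : ‖x‖ ≤ B.K * R := by
  refine B.norm_le _ _ fun n => ?_
  rw [← proj_apply]
  refine le_of_tendsto (B.tendsto_proj_of_coord h 0 n).norm (Eventually.of_forall fun i => ?_)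
  exact (B.norm_proj_le hr (Nat.zero_le n) _).trans
    (mul_le_mul_of_nonneg_left (hF i) B.K_pos.le)

/-- Iterated limits, along the hyperfilter and coordinatewise, of a bounded family indexed by
lists. -/
theorem exists_iterated_limit (hr : 0 < r) (F : List ℕ → W) (hF : ∃ R, ∀ l, ‖F l‖ ≤ R) :
    ∃ H : ℕ → List ℕ → W, H 0 = F ∧ (∀ d, ∃ R, ∀ l, ‖H d l‖ ≤ R) ∧
      ∀ d l m, Tendsto (fun t => B.coord m (H d (t :: l))) (hyperfilter ℕ : Filter ℕ)
        (𝓝 (B.coord m (H (d + 1) l))) := by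
  have step : ∀ G : {G : List ℕ → W // ∃ R, ∀ l, ‖G l‖ ≤ R},
      ∃ G' : {G : List ℕ → W // ∃ R, ∀ l, ‖G l‖ ≤ R},
        ∀ l m, Tendsto (fun t => B.coord m (G.1 (t :: l))) (hyperfilter ℕ : Filter ℕ)
          (𝓝 (B.coord m (G'.1 l))) := by
    rintro ⟨G, R, hG⟩
    choose G' hG' using fun l : List ℕ => B.exists_limit (fun t => G (t :: l)) R fun t => hG _
    -- Each limit may worsen the bound by a factor `K`; this is harmless, as only finitely many
    -- limits are used.
    exact ⟨⟨G', B.K * R, fun l => B.norm_le_of_tendsto_coord hr (fun t => hG (t :: l)) (hG' l)⟩,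
      hG'⟩
  choose T hT using step
  refine ⟨fun d => (T^[d] ⟨F, hF⟩).1, rfl, fun d => (T^[d] ⟨F, hF⟩).2, fun d l m => ?_⟩
  beta_reduce
  rw [Function.iterate_succ_apply']
  exact hT _ l m

end JamesBasis

/-! ### Real iterated limits and vertices as decreasing lists -/

/-- Iterated limits, along the hyperfilter, of a bounded real family indexed by lists. -/
theorem exists_iterated_limit_real (h : List ℕ → ℝ) (hh : ∃ R, ∀ l, |h l| ≤ R) :
    ∃ H : ℕ → List ℕ → ℝ, H 0 = h ∧
      ∀ d l, Tendsto (fun t => H d (t :: l)) (hyperfilter ℕ : Filter ℕ) (𝓝 (H (d + 1) l)) := by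
  have step : ∀ G : {G : List ℕ → ℝ // ∃ R, ∀ l, |G l| ≤ R},
      ∃ G' : {G : List ℕ → ℝ // ∃ R, ∀ l, |G l| ≤ R},
        ∀ l, Tendsto (fun t => G.1 (t :: l)) (hyperfilter ℕ : Filter ℕ) (𝓝 (G'.1 l)) := by
    rintro ⟨G, R, hG⟩
    have : ∀ l : List ℕ, ∃ y ∈ Set.Icc (-R) R,
        Tendsto (fun t => G (t :: l)) (hyperfilter ℕ : Filter ℕ) (𝓝 y) := fun l => by
      have := (isCompact_Icc (a := -R) (b := R)).ultrafilter_le_nhds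
        ((hyperfilter ℕ).map fun t : ℕ => G (t :: l))
        (by
          rw [le_principal_iff]
          exact Filter.Eventually.of_forall (p := fun t : ℕ => G (t :: l) ∈ Set.Icc (-R) R)
            fun t => abs_le.mp (hG (t :: l)))
      exact this
    choose G' hG' hlim using this
    exact ⟨⟨G', R, fun l => abs_le.mpr (hG' l)⟩, hlim⟩
  choose T hT using step
  refine ⟨fun d => (T^[d] ⟨h, hh⟩).1, rfl, fun d l => ?_⟩
  beta_reduce
  rw [Function.iterate_succ_apply']
  exact hT _ l

/-- The first `j` terms of a sequence, listed backwards. -/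
def initialList (σ : ℕ → ℕ) (j : ℕ) : List ℕ := ((List.range j).map σ).reverse

theorem initialList_succ (σ : ℕ → ℕ) (j : ℕ) :
    initialList σ (j + 1) = σ j :: initialList σ j := by
  simp [initialList, List.range_succ]

theorem initialList_zero (σ : ℕ → ℕ) : initialList σ 0 = [] := rfl

theorem length_initialList (σ : ℕ → ℕ) (j : ℕ) : (initialList σ j).length = j := by
  simp [initialList]

theorem mem_initialList {σ : ℕ → ℕ} {j x : ℕ} : x ∈ initialList σ j ↔ ∃ i < j, σ i = x := by
  simp [initialList]

theorem finite_lists_le (k s : ℕ) : {l : List ℕ | l.length ≤ k ∧ ∀ x ∈ l, x ≤ s}.Finite := by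
  refine ((List.finite_length_le (Fin (s + 1)) k).image (List.map Fin.val)).subset ?_
  rintro l ⟨hl, hs⟩
  refine ⟨l.pmap (fun x hx => ⟨x, hx⟩) fun x hx => Nat.lt_succ_of_le (hs x hx), ?_, ?_⟩
  · simpa using hl
  · rw [List.map_pmap]
    simp

/-- A vertex as the list of its elements in decreasing order. -/
def KaltonVertex.toList {k : ℕ} (v : KaltonVertex k) : List ℕ := (List.ofFn v).reverse

theorem KaltonVertex.toList_injective (k : ℕ) :
    Function.Injective (KaltonVertex.toList : KaltonVertex k → List ℕ) := fun _ _ h =>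
  DFunLike.coe_injective (List.ofFn_injective (List.reverse_injective h))

theorem toList_kaltonWindow_zero (k : ℕ) (c : ℕ → ℕ) (hc : StrictMono c) :
    (kaltonWindow k c hc 0).toList = initialList c k := by
  unfold KaltonVertex.toList initialList
  congr 1
  refine List.ext_getElem (by simp) fun i h1 h2 => ?_
  simp [kaltonWindow_apply]

/-! ### Approximation by sums of successive blocks -/

namespace JamesBasis

variable {W : Type*} [NormedAddCommGroup W] [NormedSpace ℝ W] {r : ℝ} (B : JamesBasis W r)

/-- A bounded family indexed by lists is, along all subsequences of a suitable
sequence `θ`, close to a constant plus a sum of successive blocks whose totals are almost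
constant. -/
theorem exists_block_approximation_aux (hr : 0 < r) (k : ℕ) (F : List ℕ → W)
    (hF : ∃ R, ∀ l, ‖F l‖ ≤ R) {ε : ℝ} (hε : 0 < ε) :
    ∃ (θ N : ℕ → ℕ) (w₀ : W) (γ : ℕ → ℝ), StrictMono θ ∧ StrictMono N ∧
      ∀ σ : ℕ → ℕ, StrictMono σ → ∃ b : ℕ → W,
        (∀ j, B.proj (N (σ j)) (N (σ j + 1)) (b j) = b j) ∧
        ‖F (initialList (fun i => θ (σ i)) k) - w₀ - ∑ j ∈ Finset.range k, b j‖ ≤ k * (2 * ε) ∧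
        ∀ j < k, |B.total (b j) - γ j| ≤ B.K * (2 * ε) + 2 * (k * ε) := by
  obtain ⟨H, hH0, hHb, hH⟩ := B.exists_iterated_limit hr F hF
  -- The first entries of a vertex are kept in `l`, newest at the head, and the remaining entries
  -- have been sent to infinity.
  let G : List ℕ → W := fun l => H (k - l.length) l
  have hGb : ∃ R, ∀ l, ‖G l‖ ≤ R := by
    choose R hR using hHb
    refine ⟨∑ d ∈ Finset.range (k + 1), |R d|, fun l => (hR _ l).trans ((le_abs_self _).trans ?_)⟩
    exact Finset.single_le_sum (f := fun d => |R d|) (fun _ _ => abs_nonneg _)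
      (Finset.mem_range.mpr (by omega))
  have hGlim : ∀ l : List ℕ, l.length < k → ∀ m,
      Tendsto (fun t => B.coord m (G (t :: l))) (hyperfilter ℕ : Filter ℕ)
        (𝓝 (B.coord m (G l))) := by
    intro l hl m
    have := hH (k - (l.length + 1)) l m
    rwa [show k - (l.length + 1) + 1 = k - l.length by omega] at this
  -- `total` need not commute with coordinatewise limits, so its values get iterated limits of their
  -- own.
  obtain ⟨h, hh0, hh⟩ := exists_iterated_limit_real (fun l => B.total (G l)) (by
    obtain ⟨R, hR⟩ := hGb
    exact ⟨B.K * R, fun l => (B.abs_total_le _).trans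
      (mul_le_mul_of_nonneg_left (hR l) B.K_pos.le)⟩)
  let δ : ℕ → List ℕ → W := fun t l => G (t :: l) - G l
  -- Thresholds beyond which the increments are small.
  obtain ⟨M, hM, hMδ⟩ : ∃ M : ℕ → ℕ, StrictMono M ∧
      ∀ s, ∀ l ∈ {l : List ℕ | l.length ≤ k ∧ ∀ x ∈ l, x ≤ s}, ∀ t ∈ Set.Iic s,
        ‖B.proj 0 (M s) (δ t l) - δ t l‖ ≤ ε := by
    refine extraction_forall_of_eventually (P := fun s n =>
      ∀ l ∈ {l : List ℕ | l.length ≤ k ∧ ∀ x ∈ l, x ≤ s}, ∀ t ∈ Set.Iic s,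
        ‖B.proj 0 n (δ t l) - δ t l‖ ≤ ε) fun s => ?_
    rw [eventually_all_finite (finite_lists_le k s)]
    intro l _
    rw [eventually_all_finite (Set.finite_Iic s)]
    intro t _
    filter_upwards [(Metric.tendsto_nhds.mp (B.tendsto_proj hr (δ t l))) ε hε] with n hn
    rw [← dist_eq_norm]
    exact hn.le
  -- A new entry `t` is taken so large that for every list with entries up to `s` at once, the
  -- increment is small on `[0, M s)` and each `h q` is near its limit. Handling all lists together
  -- is what makes one sequence work for all its subsequences.
  have hT : ∀ s, ∃ t, s < t ∧ ∀ l ∈ {l : List ℕ | l.length ≤ k ∧ ∀ x ∈ l, x ≤ s},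
      (l.length < k → ‖B.proj 0 (M s) (δ t l)‖ ≤ ε) ∧
        ∀ q ∈ Set.Iic k, |h q (t :: l) - h (q + 1) l| ≤ ε := by
    intro s
    have : ∀ᶠ t in (hyperfilter ℕ : Filter ℕ), s < t ∧
        ∀ l ∈ {l : List ℕ | l.length ≤ k ∧ ∀ x ∈ l, x ≤ s},
          (l.length < k → ‖B.proj 0 (M s) (δ t l)‖ ≤ ε) ∧
          ∀ q ∈ Set.Iic k, |h q (t :: l) - h (q + 1) l| ≤ ε := by
      refine ((eventually_gt_atTop s).filter_mono Nat.hyperfilter_le_atTop).and ?_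
      rw [eventually_all_finite (finite_lists_le k s)]
      intro l _
      refine Eventually.and ?_ ?_
      · by_cases hl : l.length < k
        · have h1 := B.tendsto_proj_of_coord (hGlim l hl) 0 (M s)
          filter_upwards [Metric.tendsto_nhds.mp h1 ε hε] with t ht _
          rw [dist_eq_norm, ← map_sub] at ht
          exact ht.le
        · exact Eventually.of_forall fun t ht => absurd ht hl
      · rw [eventually_all_finite (Set.finite_Iic k)]
        intro q _
        filter_upwards [Metric.tendsto_nhds.mp (hh q l) ε hε] with t ht
        rw [Real.dist_eq] at ht
        exact ht.le
    exact this.exists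
  choose T hTs hT using hT
  let τ : ℕ → ℕ := fun i => T^[i] 0
  have hτs : ∀ i, τ (i + 1) = T (τ i) := fun i => Function.iterate_succ_apply' T i 0
  have hτ : StrictMono τ := strictMono_nat_of_lt_succ fun i => by rw [hτs]; exact hTs _
  -- The entry `θ i = T (τ i)` creates an increment living essentially on `[M (τ i), M (τ (i +
  -- 1)))`. The numbers `γ j` are values at the empty list and hence independent of `σ`.
  refine ⟨fun i => τ (i + 1), fun i => M (τ i), G [], fun j => h (j + 1) [] - h j [],
    fun a b hab => hτ (Nat.succ_lt_succ hab), hM.comp hτ, fun σ hσ => ?_⟩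
  let L : ℕ → List ℕ := initialList fun i => τ (σ i + 1)
  have hL : ∀ j, L (j + 1) = τ (σ j + 1) :: L j := fun j => initialList_succ _ j
  have hLmem : ∀ j ≤ k, L j ∈ {l : List ℕ | l.length ≤ k ∧ ∀ x ∈ l, x ≤ τ (σ j)} := by
    refine fun j hj => ⟨(length_initialList _ j).trans_le hj, fun x hx => ?_⟩
    obtain ⟨i, hi, rfl⟩ := mem_initialList.mp hx
    exact hτ.monotone (hσ hi)
  have hLlen : ∀ j, (L j).length = j := fun j => length_initialList _ j
  let b : ℕ → W := fun j => B.proj (M (τ (σ j))) (M (τ (σ j + 1))) (δ (τ (σ j + 1)) (L j))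
  -- One `ε` is lost to the head of the increment and one to its tail.
  have hb : ∀ j < k, ‖δ (τ (σ j + 1)) (L j) - b j‖ ≤ 2 * ε := by
    intro j hj
    have h1 := hMδ (τ (σ j + 1)) (L j)
      ⟨(hLmem j hj.le).1, fun x hx => ((hLmem j hj.le).2 x hx).trans (hτ.monotone (Nat.le_succ _))⟩
      (τ (σ j + 1)) (Set.mem_Iic.mpr le_rfl)
    have h2 := (hT (τ (σ j)) (L j) (hLmem j hj.le)).1 (by rw [hLlen]; exact hj)
    rw [← hτs] at h2
    have h3 : δ (τ (σ j + 1)) (L j) - b j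
        = B.proj 0 (M (τ (σ j))) (δ (τ (σ j + 1)) (L j)) -
          (B.proj 0 (M (τ (σ j + 1))) (δ (τ (σ j + 1)) (L j)) - δ (τ (σ j + 1)) (L j)) := by
      simp only [b]
      rw [← B.proj_sub_proj (hM.monotone (hτ.monotone (Nat.le_succ _)))]
      abel
    rw [h3]
    exact (norm_sub_le _ _).trans (by linarith)
  -- Each removal of an entry trades it for one more limit, at a cost of `ε`.
  have hchain : ∀ i ≤ k, ∀ q, q + i ≤ k → |h q (L i) - h (q + i) []| ≤ i * ε := by
    intro i
    induction i with
    | zero => intro _ q _; simp [L, initialList_zero]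
    | succ i ih =>
      intro hi q hq
      have h1 := ih (by omega) (q + 1) (by omega)
      have h2 := (hT (τ (σ i)) (L i) (hLmem i (by omega))).2 q (Set.mem_Iic.mpr (by omega))
      rw [← hτs, ← hL] at h2
      rw [show q + (i + 1) = q + 1 + i by ring]
      have := abs_sub_le (h q (L (i + 1))) (h (q + 1) (L i)) (h (q + 1 + i) [])
      push_cast
      linarith
  refine ⟨b, fun j => B.proj_proj_self _ _ _, ?_, fun j hj => ?_⟩
  · have h1 : F (L k) - G [] = ∑ j ∈ Finset.range k, δ (τ (σ j + 1)) (L j) := by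
      have h2 : F (L k) = G (L k) := by
        simp only [G]
        rw [hLlen, Nat.sub_self, hH0]
      rw [h2, ← initialList_zero fun i => τ (σ i + 1)]
      rw [← Finset.sum_range_sub (fun j => G (L j))]
      exact Finset.sum_congr rfl fun j _ => by rw [hL]
    change ‖F (L k) - G [] - ∑ j ∈ Finset.range k, b j‖ ≤ _
    rw [h1, ← Finset.sum_sub_distrib]
    refine (norm_sum_le_of_le _ fun j hj => hb j (Finset.mem_range.mp hj)).trans ?_
    simp
  · have h1 := hchain (j + 1) hj 0 (by omega)
    have h2 := hchain j hj.le 0 (by omega)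
    have h3 := (B.abs_total_le _).trans (mul_le_mul_of_nonneg_left (hb j hj) B.K_pos.le)
    have h4 : B.total (δ (τ (σ j + 1)) (L j)) = h 0 (L (j + 1)) - h 0 (L j) := by
      simp only [hh0, δ, map_sub, hL]
    rw [map_sub, h4] at h3
    rw [zero_add] at h1 h2
    have hjk : ((j + 1 : ℕ) : ℝ) * ε ≤ k * ε :=
      mul_le_mul_of_nonneg_right (by exact_mod_cast hj) hε.le
    have hjk' : (j : ℝ) * ε ≤ k * ε :=
      mul_le_mul_of_nonneg_right (by exact_mod_cast hj.le) hε.le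
    rw [abs_le] at *
    constructor <;> linarith [h1.1, h1.2, h2.1, h2.2, h3.1, h3.2]

theorem exists_block_approximation (hr : 0 < r) (k : ℕ) (f : KaltonVertex k → W)
    (hf : ∃ R, ∀ v, ‖f v‖ ≤ R) {η : ℝ} (hη : 0 < η) :
    ∃ (θ N : ℕ → ℕ) (w₀ : W) (γ : ℕ → ℝ) (hθ : StrictMono θ), StrictMono N ∧
      ∀ (σ : ℕ → ℕ) (hσ : StrictMono σ), ∃ b : ℕ → W,
        (∀ j, B.proj (N (σ j)) (N (σ j + 1)) (b j) = b j) ∧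
        ‖f (kaltonWindow k (fun i => θ (σ i)) (hθ.comp hσ) 0) - w₀ - ∑ j ∈ Finset.range k, b j‖
          ≤ η ∧
        ∀ j < k, |B.total (b j) - γ j| ≤ η := by
  have hK := B.K_pos
  have hk : (0 : ℝ) ≤ k := Nat.cast_nonneg k
  have hD : 0 < 2 * B.K + 2 * (k : ℝ) := by linarith
  obtain ⟨R, hR⟩ := hf
  obtain ⟨θ, N, w₀, γ, hθ, hN, H⟩ := B.exists_block_approximation_aux hr k
    -- Lists that come from no vertex get the value 0. The accuracy `η / (2K + 2k)` makes both error
    -- terms at most `η`.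
    (Function.extend KaltonVertex.toList f 0) ⟨max R 0, fun l => by
      by_cases hl : ∃ v : KaltonVertex k, v.toList = l
      · obtain ⟨v, rfl⟩ := hl
        rw [(KaltonVertex.toList_injective k).extend_apply]
        exact (hR v).trans (le_max_left _ _)
      · rw [Function.extend_apply' _ _ _ hl]
        simp⟩ (div_pos hη hD)
  refine ⟨θ, N, w₀, γ, hθ, hN, fun σ hσ => ?_⟩
  obtain ⟨b, hb1, hb2, hb3⟩ := H σ hσ
  have hε : (2 * B.K + 2 * (k : ℝ)) * (η / (2 * B.K + 2 * (k : ℝ))) = η := by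
    field_simp
  have hε0 : 0 < η / (2 * B.K + 2 * (k : ℝ)) := div_pos hη hD
  refine ⟨b, hb1, ?_, fun j hj => (hb3 j hj).trans (by linarith)⟩
  rw [← toList_kaltonWindow_zero k (fun i => θ (σ i)) (hθ.comp hσ),
    (KaltonVertex.toList_injective k).extend_apply] at hb2
  exact hb2.trans (by nlinarith)

end JamesBasis

/-! ### Distances in the interlaced graphs -/

theorem kalton_dist_def {k : ℕ} (n m : KaltonVertex k) :
    dist n m = ((kaltonGraph k).dist n m : ℝ) := rfl

theorem KaltonVertex.strictMono {k : ℕ} (n : KaltonVertex k) : StrictMono n :=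
  OrderEmbedding.strictMono (show Fin k ↪o ℕ from n)

theorem Interlaced.dist_le_one {k : ℕ} {n m : KaltonVertex k} (h : Interlaced n m) :
    dist n m ≤ 1 := by
  by_cases hnm : n = m
  · rw [hnm, dist_self]
    exact zero_le_one
  · have hadj : (kaltonGraph k).Adj n m := ⟨hnm, Or.inl h⟩
    rw [kalton_dist_def, SimpleGraph.dist_eq_one_iff_adj.mpr hadj, Nat.cast_one]

theorem interlaced_kaltonWindow {k : ℕ} {c c' : ℕ → ℕ} (hc : StrictMono c) (hc' : StrictMono c')
    (h : ∀ i, c i ≤ c' i) (h' : ∀ i, c' i ≤ c (i + 1)) :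
    Interlaced (kaltonWindow k c hc 0) (kaltonWindow k c' hc' 0) := by
  refine ⟨fun i => ?_, fun i j hij => ?_⟩
  · simp only [kaltonWindow_apply]
    exact h _
  · simp only [kaltonWindow_apply, zero_add, ← hij]
    exact h' _

theorem dist_kaltonWindow_le (k : ℕ) (c : ℕ → ℕ) (hc : StrictMono c) (j : ℕ) :
    dist (kaltonWindow k c hc 0) (kaltonWindow k c hc j) ≤ j := by
  induction j with
  | zero => simp
  | succ j ih =>
    refine (dist_triangle _ (kaltonWindow k c hc j) _).trans ?_
    push_cast
    refine add_le_add ih (Interlaced.dist_le_one ⟨fun i => ?_, fun a b hab => ?_⟩)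
    · simp only [kaltonWindow_apply]
      exact hc.monotone (by omega)
    · simp only [kaltonWindow_apply]
      exact hc.monotone (by omega)

/-- Continue `n` by the far tail to one increasing sequence and slide a window of length `k` along
it, one edge at a time. -/
theorem dist_kalton_far_le {k : ℕ} (n : KaltonVertex k) (B : ℕ) (hB : ∀ i, n i < B)
    (hs : StrictMono fun i : ℕ => B + i) :
    dist n (kaltonWindow k (fun i => B + i) hs k) ≤ k := by
  have hc : StrictMono (fun i : ℕ => if h : i < k then n ⟨i, h⟩ else B + i) := by
    intro a b hab
    by_cases hb : b < k
    · have ha : a < k := hab.trans hb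
      simp only [ha, hb, dif_pos]
      exact n.strictMono hab
    · by_cases ha : a < k
      · simp only [ha, hb, dif_pos, dif_neg, not_false_eq_true]
        have := hB ⟨a, ha⟩
        omega
      · simp only [ha, hb, dif_neg, not_false_eq_true]
        omega
  have h := dist_kaltonWindow_le k _ hc k
  have h0 : kaltonWindow k _ hc 0 = n := by
    apply DFunLike.ext
    intro i
    simp [kaltonWindow_apply]
  have h1 : kaltonWindow k _ hc k = kaltonWindow k (fun i => B + i) hs k := by
    apply DFunLike.ext
    intro i
    simp [kaltonWindow_apply]
  rwa [h0, h1] at h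

/-- Any two vertices are within `k` of a common far vertex. Finite diameter is what makes a coarse
embedding bounded on each single graph. -/
theorem kalton_dist_le {k : ℕ} (n m : KaltonVertex k) : dist n m ≤ 2 * k := by
  let B := (∑ i, n i) + (∑ i, m i) + 1
  have hs : StrictMono fun i : ℕ => B + i := fun a b h => Nat.add_lt_add_left h B
  have hn : ∀ i, n i < B := fun i => by
    have := Finset.single_le_sum (f := fun i => n i) (fun _ _ => Nat.zero_le _)
      (Finset.mem_univ i)
    simp only [B]; omega
  have hm : ∀ i, m i < B := fun i => by
    have := Finset.single_le_sum (f := fun i => m i) (fun _ _ => Nat.zero_le _)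
      (Finset.mem_univ i)
    simp only [B]; omega
  have h1 := dist_kalton_far_le n B hn hs
  have h2 := dist_kalton_far_le m B hm hs
  have := dist_triangle_right n m (kaltonWindow k (fun i => B + i) hs k)
  linarith

/-- In the interlaced graph a path of length `d` shifts the entries by at most `d` places. -/
theorem apply_le_apply_add_length {k : ℕ} {n m : KaltonVertex k} (p : (kaltonGraph k).Walk n m) :
    ∀ (j : ℕ) (hj : j + p.length < k), m ⟨j, by omega⟩ ≤ n ⟨j + p.length, hj⟩ := by
  induction p with
  | nil => intro j hj; exact le_rfl
  | @cons n n' m h p ih =>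
    intro j hj
    rw [SimpleGraph.Walk.length_cons] at hj
    refine (ih j (by omega)).trans ?_
    have hstep : ∀ (i : ℕ) (hi : i + 1 < k), n' ⟨i, by omega⟩ ≤ n ⟨i + 1, hi⟩ := by
      intro i hi
      rcases h.2 with h | h
      · exact h.2 _ _ rfl
      · exact (h.1 _).trans (n.strictMono.monotone (Fin.mk_le_mk.mpr (Nat.le_succ i)))
    exact hstep _ (by omega)

/-- A path of length `d < l` would force `m j ≤ n (j + d)`. -/
theorem le_kalton_dist {k : ℕ} {n m : KaltonVertex k} {j l : ℕ} (hjl : j + l ≤ k)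
    (h : ∀ d (hd : d < l), n ⟨j + d, by omega⟩ < m ⟨j, by omega⟩) : (l : ℝ) ≤ dist n m := by
  rw [kalton_dist_def]
  norm_cast
  by_contra! hlt
  obtain ⟨p, hp⟩ := (kaltonGraph_connected k).exists_walk_length_eq_dist n m
  have h1 := apply_le_apply_add_length p j (by omega)
  have h2 := h p.length (by omega)
  omega

/-! ### Lower and upper estimates for block sums -/

namespace JamesBasis

variable {W : Type*} [NormedAddCommGroup W] [NormedSpace ℝ W] {r : ℝ} (B : JamesBasis W r)

theorem proj_sum_blocks {N σ : ℕ → ℕ} (hN : StrictMono N) (hσ : StrictMono σ) {b : ℕ → W}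
    (hb : ∀ j, B.proj (N (σ j)) (N (σ j + 1)) (b j) = b j) {j k : ℕ} (hj : j < k) :
    B.proj (N (σ j)) (N (σ j + 1)) (∑ i ∈ Finset.range k, b i) = b j := by
  rw [map_sum, Finset.sum_eq_single j, hb]
  · intro i _ hij
    rw [← hb i]
    refine B.proj_proj_of_disjoint ?_ _
    rcases lt_or_gt_of_ne hij with h | h
    · exact Or.inr (hN.monotone (hσ h))
    · exact Or.inl (hN.monotone (hσ h))
  · intro h
    exact absurd (Finset.mem_range.mpr hj) h

theorem proj_sum_blocks_of_ne {N σ : ℕ → ℕ} (hN : StrictMono N) {b : ℕ → W}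
    (hb : ∀ j, B.proj (N (σ j)) (N (σ j + 1)) (b j) = b j) {i : ℕ} (hi : ∀ j, σ j ≠ i) (k : ℕ) :
    B.proj (N i) (N (i + 1)) (∑ j ∈ Finset.range k, b j) = 0 := by
  rw [map_sum]
  refine Finset.sum_eq_zero fun j _ => ?_
  rw [← hb j]
  refine B.proj_proj_of_disjoint ?_ _
  rcases lt_or_gt_of_ne (hi j) with h | h
  · exact Or.inr (hN.monotone h)
  · exact Or.inl (hN.monotone h)

/-- The lower estimate for a difference of two interlaced sums of blocks. -/
theorem sum_norm_rpow_le_of_interlaced {N σ : ℕ → ℕ} (hN : StrictMono N)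
    (hσ : ∀ j, σ j + 1 < σ (j + 1)) {b b' : ℕ → W}
    (hb : ∀ j, B.proj (N (σ j)) (N (σ j + 1)) (b j) = b j)
    (hb' : ∀ j, B.proj (N (σ j + 1)) (N (σ j + 1 + 1)) (b' j) = b' j) (k : ℕ) :
    ∑ j ∈ Finset.range k, ‖b j‖ ^ r ≤
      (B.K * ‖∑ j ∈ Finset.range k, b j - ∑ j ∈ Finset.range k, b' j‖) ^ r := by
  have hσm : StrictMono σ := strictMono_nat_of_lt_succ fun j => by have := hσ j; omega
  -- The gaps in `σ` leave room for the shifted sequence, so the intervals of `b'` miss those of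
  -- `b`, and projecting the difference onto the j-th interval returns `b j`.
  have hne : ∀ i j, σ i + 1 ≠ σ j := by
    intro i j
    rcases le_or_gt j i with h | h
    · have := hσm.monotone h; omega
    · have := hσm.monotone (Nat.succ_le_of_lt h)
      have := hσ i
      simp only [Nat.succ_eq_add_one] at *
      omega
  refine le_trans (le_of_eq (Finset.sum_congr rfl fun j hj => ?_))
    (B.lower (fun j => N (σ j)) (fun j => N (σ j + 1)) (fun j => hN.monotone (Nat.le_succ _))
      (fun j => hN.monotone (hσm (Nat.lt_succ_self j))) _ k)
  rw [← proj_apply, map_sub, B.proj_sum_blocks hN hσm hb (Finset.mem_range.mp hj),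
    B.proj_sum_blocks_of_ne (σ := fun j => σ j + 1) hN hb' (fun i => hne i j), sub_zero]

/-- The upper estimate for a sum of blocks with their totals removed. -/
theorem norm_sum_sub_total_le (hr : 0 < r) {N σ : ℕ → ℕ} (hN : StrictMono N) (hσ : StrictMono σ)
    {b : ℕ → W} (hb : ∀ j, B.proj (N (σ j)) (N (σ j + 1)) (b j) = b j) {k : ℕ} {A : ℝ}
    (hA : 0 ≤ A) (hbA : ∑ j ∈ Finset.range k, ‖b j‖ ^ r ≤ A ^ r) :
    ‖∑ j ∈ Finset.range k, (b j - B.total (b j) • B.vec (N (σ j)))‖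
      ≤ B.K * ((1 + B.K * B.K) * A) := by
  have hK := B.K_pos
  -- Correcting the total costs a factor `1 + K²`: one `K` for `total`, one for the basis vector.
  have hz : ∀ j, ‖b j - B.total (b j) • B.vec (N (σ j))‖ ≤ (1 + B.K * B.K) * ‖b j‖ := by
    intro j
    refine (norm_sub_le _ _).trans ?_
    rw [norm_smul, Real.norm_eq_abs]
    have := mul_le_mul (B.abs_total_le (b j)) (B.norm_vec_le (N (σ j))) (norm_nonneg _)
      (mul_nonneg hK.le (norm_nonneg _))
    linarith
  have hC : 0 ≤ 1 + B.K * B.K := by positivity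
  refine (Real.rpow_le_rpow_iff (norm_nonneg _) (by positivity) hr).mp ?_
  refine (B.upper (fun j => N (σ j)) (fun j => N (σ j + 1)) (fun j => hN.monotone (Nat.le_succ _))
      (fun j => hN.monotone (hσ (Nat.lt_succ_self j))) _ k ?_ ?_).trans ?_
  · intro j _
    rw [← proj_apply, map_sub, map_smul, hb, B.proj_vec]
    exact Finset.mem_Ico.mpr ⟨le_rfl, hN (Nat.lt_succ_self _)⟩
  · intro j _
    rw [map_sub, map_smul, B.total_vec, smul_eq_mul, mul_one, sub_self]
  · rw [Real.mul_rpow hK.le (by positivity), Real.mul_rpow hC hA]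
    refine mul_le_mul_of_nonneg_left ?_ (by positivity)
    refine le_trans ?_ (mul_le_mul_of_nonneg_left hbA (by positivity))
    rw [Finset.mul_sum]
    refine Finset.sum_le_sum fun j _ => ?_
    rw [← Real.mul_rpow hC (norm_nonneg _)]
    exact Real.rpow_le_rpow (norm_nonneg _) (hz j) hr.le

end JamesBasis

/-! ### Far apart vertices with close images -/

/-- Among `q` successive intervals of length `l` there is one on which all the terms are small. -/
theorem exists_interval_le {s : ℕ → ℝ} (hs : ∀ j, 0 ≤ s j) {r A : ℝ} (hr : 0 < r) {l q : ℕ}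
    (hl : 0 < l) (h : ∑ j ∈ Finset.range (q * l), s j ^ r ≤ A ^ r) (hA : 0 ≤ A)
    (hq : (A * l) ^ r < q) : ∃ a < q, ∀ i < l, s (a * l + i) ≤ 1 / l := by
  by_contra! hcon
  -- One large term per interval: these `q` distinct indices alone contribute at least `q / l ^ r`,
  -- more than `A ^ r`.
  choose! i hi hsi using hcon
  have hl' : (0 : ℝ) < l := by exact_mod_cast hl
  have hinj : Set.InjOn (fun a => a * l + i a) (Finset.range q) := by
    intro a ha b hb hab
    have ha' := hi a (Finset.mem_range.mp ha)
    have hb' := hi b (Finset.mem_range.mp hb)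
    have h1 : (a * l + i a) / l = a := by
      rw [mul_comm, Nat.mul_add_div hl, Nat.div_eq_of_lt ha', add_zero]
    have h2 : (b * l + i b) / l = b := by
      rw [mul_comm, Nat.mul_add_div hl, Nat.div_eq_of_lt hb', add_zero]
    simp only at hab
    rw [← h1, ← h2, hab]
  have hsub : (Finset.range q).image (fun a => a * l + i a) ⊆ Finset.range (q * l) := by
    intro x hx
    obtain ⟨a, ha, rfl⟩ := Finset.mem_image.mp hx
    have ha := Finset.mem_range.mp ha
    have := hi a ha
    have h2 : (a + 1) * l ≤ q * l := Nat.mul_le_mul_right l ha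
    rw [Finset.mem_range]
    linarith
  have h1 := Finset.sum_le_sum_of_subset_of_nonneg hsub
    (f := fun j => s j ^ r) fun j _ _ => Real.rpow_nonneg (hs j) r
  rw [Finset.sum_image hinj] at h1
  have h2 : ∑ _a ∈ Finset.range q, (1 / (l : ℝ)) ^ r
      ≤ ∑ a ∈ Finset.range q, s (a * l + i a) ^ r :=
    Finset.sum_le_sum fun a ha => Real.rpow_le_rpow (by positivity)
      (hsi a (Finset.mem_range.mp ha)).le hr.le
  rw [Finset.sum_const, Finset.card_range, nsmul_eq_mul, Real.div_rpow zero_le_one hl'.le,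
    Real.one_rpow] at h2
  have h3 : 0 < (l : ℝ) ^ r := Real.rpow_pos_of_pos hl' r
  rw [Real.mul_rpow hA hl'.le] at hq
  have h4 : (q : ℝ) * (1 / (l : ℝ) ^ r) ≤ A ^ r := h2.trans (h1.trans h)
  rw [mul_one_div, div_le_iff₀ h3] at h4
  linarith

namespace JamesBasis

variable {W : Type*} [NormedAddCommGroup W] [NormedSpace ℝ W] {r : ℝ}

/-- Bounded maps on a high-dimensional interlaced graph with increments at most `L` along the edges
send some far apart vertices to points whose distance is controlled by `L` only. -/
theorem exists_far_pair (B : JamesBasis W r) (hr : 0 < r) {L : ℝ} (hL : 0 ≤ L) :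
    ∃ D : ℝ, ∀ l : ℕ, 0 < l → ∃ k : ℕ, 0 < k ∧ ∀ f : KaltonVertex k → W,
      (∃ R, ∀ v, ‖f v‖ ≤ R) → (∀ n m, Interlaced n m → ‖f n - f m‖ ≤ L) →
        ∃ n m, (l : ℝ) ≤ dist n m ∧ ‖f n - f m‖ ≤ D := by
  have hK := B.K_pos
  -- The edge increment `L`, plus two approximation errors of total at most 1, times the lower
  -- constant.
  let A : ℝ := B.K * (L + 1)
  have hA : 0 ≤ A := by positivity
  refine ⟨2 * (B.K * ((1 + B.K * B.K) * A)) + (2 * B.K + 2 * B.K * B.K) + 1, fun l hl => ?_⟩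
  obtain ⟨q, hq⟩ := exists_nat_gt ((A * l) ^ r)
  have hq0 : 0 < q := by
    have : (0 : ℝ) < q := lt_of_le_of_lt (by positivity) hq
    exact_mod_cast this
  refine ⟨q * l, Nat.mul_pos hq0 hl, fun f hf hfL => ?_⟩
  let k := q * l
  have hk0 : (0 : ℝ) ≤ k := Nat.cast_nonneg k
  -- Small enough that even `k` errors of size `2 * η` add up to at most 1.
  let η : ℝ := 1 / (2 * (k + 1))
  have hη : 0 < η := by positivity
  have hη2 : 2 * η ≤ 1 := by
    simp only [η]
    rw [mul_one_div, div_le_one (by positivity)]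
    linarith
  have hkη : k * (2 * η) ≤ 1 := by
    simp only [η]
    rw [mul_one_div, mul_div_assoc', div_le_one (by positivity)]
    linarith
  obtain ⟨θ, N, w₀, γ, hθ, hN, H⟩ := B.exists_block_approximation hr k f hf hη
  -- All sums of blocks along sparse sequences satisfy the lower estimate.
  have key : ∀ σ : ℕ → ℕ, (∀ j, σ j + 1 < σ (j + 1)) → ∀ b : ℕ → W,
      (∀ j, B.proj (N (σ j)) (N (σ j + 1)) (b j) = b j) → ∀ hσ : StrictMono σ,
      ‖f (kaltonWindow k (fun i => θ (σ i)) (hθ.comp hσ) 0) - w₀ - ∑ j ∈ Finset.range k, b j‖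
          ≤ η → ∑ j ∈ Finset.range k, ‖b j‖ ^ r ≤ A ^ r := by
    intro σ hσg b hb hσ hbf
    have hσ' : StrictMono fun i => σ i + 1 := fun i j hij => Nat.succ_lt_succ (hσ hij)
    -- The vertex shifted by one is interlaced with the original, yet its blocks occupy different
    -- intervals.
    obtain ⟨b', hb', hbf', -⟩ := H (fun i => σ i + 1) hσ'
    refine (B.sum_norm_rpow_le_of_interlaced hN hσg hb hb' k).trans ?_
    refine Real.rpow_le_rpow (by positivity) (mul_le_mul_of_nonneg_left ?_ hK.le) hr.le
    have hadj := hfL _ _ (interlaced_kaltonWindow (k := k) (hθ.comp hσ) (hθ.comp hσ')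
      (fun i => hθ.monotone (Nat.le_succ _)) (fun i => hθ.monotone (hσg i).le))
    have heq : ∑ j ∈ Finset.range k, b j - ∑ j ∈ Finset.range k, b' j
        = (f (kaltonWindow k (fun i => θ (σ i)) (hθ.comp hσ) 0)
            - f (kaltonWindow k (fun i => θ (σ i + 1)) (hθ.comp hσ') 0))
          - (f (kaltonWindow k (fun i => θ (σ i)) (hθ.comp hσ) 0) - w₀
              - ∑ j ∈ Finset.range k, b j)
          + (f (kaltonWindow k (fun i => θ (σ i + 1)) (hθ.comp hσ') 0) - w₀
              - ∑ j ∈ Finset.range k, b' j) := by abel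
    rw [heq]
    refine (norm_add_le _ _).trans ?_
    refine (add_le_add_left (norm_sub_le _ _) _).trans ?_
    exact (add_le_add (add_le_add hadj hbf) hbf').trans (by linarith)
  have h2 : ∀ j : ℕ, 2 * j + 1 < 2 * (j + 1) := fun j => by omega
  have h2m : StrictMono fun j : ℕ => 2 * j := fun i j hij => by dsimp only; omega
  -- A reference vertex: its blocks locate `l` consecutive positions at which the universal totals
  -- `γ j` are small.
  obtain ⟨b₀, hb₀, hbf₀, hbγ₀⟩ := H (fun j => 2 * j) h2m
  obtain ⟨a, haq, ha⟩ := exists_interval_le (fun j => norm_nonneg (b₀ j)) hr hl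
    (key _ h2 b₀ hb₀ h2m hbf₀) hA hq
  have hak : a * l + l ≤ k := by
    have := Nat.mul_le_mul_right l (Nat.succ_le_of_lt haq)
    simp only [k]
    rw [Nat.succ_mul] at this
    exact this
  -- Both sequences equal `2 * j` before the chosen interval and `2 * (j + l)` after it. Inside it,
  -- `σ` has not jumped yet while `τ` already has, so there all `l` entries of `σ` lie below the
  -- first one of `τ`.
  let σ : ℕ → ℕ := fun j => if j < a * l + l then 2 * j else 2 * (j + l)
  let τ : ℕ → ℕ := fun j => if j < a * l then 2 * j else 2 * (j + l)
  have hσg : ∀ j, σ j + 1 < σ (j + 1) := fun j => by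
    simp only [σ]
    split_ifs <;> omega
  have hτg : ∀ j, τ j + 1 < τ (j + 1) := fun j => by
    simp only [τ]
    split_ifs <;> omega
  have hσ : StrictMono σ := strictMono_nat_of_lt_succ fun j => by have := hσg j; omega
  have hτ : StrictMono τ := strictMono_nat_of_lt_succ fun j => by have := hτg j; omega
  obtain ⟨b, hb, hbf, hbγ⟩ := H σ hσ
  obtain ⟨b', hb', hbf', hbγ'⟩ := H τ hτ
  refine ⟨kaltonWindow k (fun i => θ (σ i)) (hθ.comp hσ) 0,
    kaltonWindow k (fun i => θ (τ i)) (hθ.comp hτ) 0, ?_, ?_⟩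
  · refine le_kalton_dist (j := a * l) hak fun d hd => ?_
    simp only [kaltonWindow_apply, zero_add]
    refine hθ ?_
    simp only [σ, τ]
    split_ifs <;> omega
  · have hu := B.norm_sum_sub_total_le hr hN hσ hb hA (key σ hσg b hb hσ hbf)
    have hu' := B.norm_sum_sub_total_le hr hN hτ hb' hA (key τ hτg b' hb' hτ hbf')
    let J : ℕ → ℝ := fun j => if j ∈ Finset.Ico (a * l) (a * l + l) then ‖b₀ j‖ else 0
    have hJ : ∑ j ∈ Finset.range k, J j ≤ 1 := by
      rw [Finset.sum_ite_mem, Finset.inter_eq_right.mpr]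
      · rw [Finset.sum_Ico_eq_sum_range, Nat.add_sub_cancel_left]
        refine (Finset.sum_le_sum fun i hi => ha i (Finset.mem_range.mp hi)).trans ?_
        rw [Finset.sum_const, Finset.card_range, nsmul_eq_mul, mul_one_div_cancel]
        exact_mod_cast hl.ne'
      · intro j hj
        rw [Finset.mem_Ico] at hj
        exact Finset.mem_range.mpr (hj.2.trans_le hak)
    -- Inside the interval both coefficients are controlled by `‖b₀ j‖` through `γ j`; outside it
    -- the basis vectors coincide and the coefficients differ by at most `2 * η`.
    have hterm : ∀ j < k, ‖B.total (b j) • B.vec (N (σ j)) - B.total (b' j) • B.vec (N (τ j))‖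
        ≤ 2 * B.K * (2 * η) + 2 * B.K * B.K * J j := by
      intro j hj
      by_cases hjJ : j ∈ Finset.Ico (a * l) (a * l + l)
      · simp only [J, if_pos hjJ]
        have hγ : |γ j| ≤ B.K * ‖b₀ j‖ + η := by
          have h1 := B.abs_total_le (b₀ j)
          have h2 := hbγ₀ j hj
          rw [abs_le] at *
          constructor <;> linarith [h1.1, h1.2, h2.1, h2.2]
        have hc : ∀ c : ℝ, |c - γ j| ≤ η → ∀ i, ‖c • B.vec i‖ ≤ (B.K * ‖b₀ j‖ + 2 * η) * B.K := by
          intro c hc i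
          rw [norm_smul, Real.norm_eq_abs]
          refine mul_le_mul ?_ (B.norm_vec_le i) (norm_nonneg _) (by positivity)
          rw [abs_le] at *
          constructor <;> linarith [hγ.1, hγ.2, hc.1, hc.2]
        refine (norm_sub_le _ _).trans
          ((add_le_add (hc _ (hbγ j hj) (N (σ j))) (hc _ (hbγ' j hj) (N (τ j)))).trans ?_)
        linarith
      · simp only [J, if_neg hjJ, mul_zero, add_zero]
        have hστ : σ j = τ j := by
          rw [Finset.mem_Ico] at hjJ
          simp only [σ, τ]
          split_ifs <;> omega
        rw [hστ, ← sub_smul, norm_smul, Real.norm_eq_abs]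
        have h1 : |B.total (b j) - B.total (b' j)| ≤ 2 * η := by
          have h1 := hbγ j hj
          have h2 := hbγ' j hj
          rw [abs_le] at *
          constructor <;> linarith [h1.1, h1.2, h2.1, h2.2]
        have := mul_le_mul h1 (B.norm_vec_le (N (τ j))) (norm_nonneg _) (by positivity)
        nlinarith
    have hsum : ‖∑ j ∈ Finset.range k,
        (B.total (b j) • B.vec (N (σ j)) - B.total (b' j) • B.vec (N (τ j)))‖
          ≤ 2 * B.K + 2 * B.K * B.K := by
      refine (norm_sum_le_of_le _ fun j hj => hterm j (Finset.mem_range.mp hj)).trans ?_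
      rw [Finset.sum_add_distrib, Finset.sum_const, Finset.card_range, nsmul_eq_mul,
        ← Finset.mul_sum]
      have h1 := mul_le_mul_of_nonneg_left hkη hK.le
      have h2 := mul_le_mul_of_nonneg_left hJ (mul_pos hK hK).le
      linarith
    -- Two sums of corrected blocks, the difference of the total parts, and the two approximation
    -- errors.
    have heq : f (kaltonWindow k (fun i => θ (σ i)) (hθ.comp hσ) 0)
          - f (kaltonWindow k (fun i => θ (τ i)) (hθ.comp hτ) 0)
        = ∑ j ∈ Finset.range k, (b j - B.total (b j) • B.vec (N (σ j)))
          - ∑ j ∈ Finset.range k, (b' j - B.total (b' j) • B.vec (N (τ j)))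
          + ∑ j ∈ Finset.range k,
            (B.total (b j) • B.vec (N (σ j)) - B.total (b' j) • B.vec (N (τ j)))
          + ((f (kaltonWindow k (fun i => θ (σ i)) (hθ.comp hσ) 0) - w₀
              - ∑ j ∈ Finset.range k, b j)
            - (f (kaltonWindow k (fun i => θ (τ i)) (hθ.comp hτ) 0) - w₀
              - ∑ j ∈ Finset.range k, b' j)) := by
      simp only [Finset.sum_sub_distrib]
      abel
    rw [heq]
    refine (norm_add_le _ _).trans (add_le_add ((norm_add_le _ _).trans
      (add_le_add ((norm_sub_le _ _).trans ?_) hsum)) ((norm_sub_le _ _).trans ?_))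
    · linarith
    · linarith

/-- The Kalton interlaced graphs do not equi-coarsely embed into a space with a James basis. -/
theorem not_equiCoarselyEmbeds (B : JamesBasis W r) (hr : 0 < r) :
    ¬ EquiCoarselyEmbeds (fun k : ℕ+ => KaltonVertex k) W := by
  rintro ⟨ρ, ω, f, hρ, H⟩
  have hω : ∀ (k : ℕ+) (t : ℝ≥0) (n m : KaltonVertex k), dist n m ≤ t →
      ‖f k n - f k m‖ ≤ ω t := by
    intro k t n m h
    have h1 : edist (f k n) (f k m) ≤ expansionModulus (f k) t :=
      le_iSup_of_le n (le_iSup_of_le m (le_iSup_of_le h le_rfl))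
    have h2 := h1.trans (H k t).2
    rw [edist_nndist, ENNReal.coe_le_coe] at h2
    rw [← dist_eq_norm]
    exact_mod_cast h2
  have hρ' : ∀ (k : ℕ+) (t : ℝ≥0) (n m : KaltonVertex k), t ≤ dist n m →
      ρ t ≤ ‖f k n - f k m‖ := by
    intro k t n m h
    have h1 : compressionModulus (f k) t ≤ edist (f k n) (f k m) :=
      iInf_le_of_le n (iInf_le_of_le m (iInf_le_of_le h le_rfl))
    have h2 := (H k t).1.trans h1
    rw [edist_nndist, ENNReal.coe_le_coe] at h2
    rw [← dist_eq_norm]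
    exact_mod_cast h2
  obtain ⟨D, hD⟩ := B.exists_far_pair hr (ω 1).2
  have hρD : ∀ᶠ l : ℕ in atTop, D.toNNReal + 1 ≤ ρ l :=
    (hρ.comp tendsto_natCast_atTop_atTop).eventually_ge_atTop _
  obtain ⟨l, hl, hl0⟩ := (hρD.and (eventually_gt_atTop 0)).exists
  obtain ⟨k, hk, hkf⟩ := hD l hl0
  obtain ⟨n, m, hnm, hfD⟩ := hkf (f ⟨k, hk⟩) (by
    let v : KaltonVertex k := kaltonWindow k id strictMono_id 0
    refine ⟨ω (2 * k) + ‖f ⟨k, hk⟩ v‖, fun w => ?_⟩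
    have h1 := hω ⟨k, hk⟩ (2 * k) w v (by
      push_cast
      exact kalton_dist_le (k := k) w v)
    have h2 := norm_add_le (f ⟨k, hk⟩ w - f ⟨k, hk⟩ v) (f ⟨k, hk⟩ v)
    rw [sub_add_cancel] at h2
    linarith)
    (fun n m h => hω ⟨k, hk⟩ 1 n m (by rw [NNReal.coe_one]; exact h.dist_le_one))
  have h1 := hρ' ⟨k, hk⟩ l n m (by rw [NNReal.coe_natCast]; exact hnm)
  have h2 : ((D.toNNReal + 1 : ℝ≥0) : ℝ) ≤ ρ l := by exact_mod_cast hl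
  rw [NNReal.coe_add, NNReal.coe_one] at h2
  have := Real.le_coe_toNNReal D
  linarith

end JamesBasis

/-! ### The James norm: p-variation, windows, and estimates -/

/-- The sum of the `p`-th powers of the first `M` increments of `x` along `u`. -/
noncomputable def varSum (p : ℝ) (x : ℕ → ℝ) (M : ℕ) (u : ℕ → ℕ) : ℝ :=
  ∑ i ∈ Finset.range M, |x (u (i + 1)) - x (u i)| ^ p

theorem varSum_nonneg (p : ℝ) (x : ℕ → ℝ) (M : ℕ) (u : ℕ → ℕ) : 0 ≤ varSum p x M u :=
  Finset.sum_nonneg fun _ _ => Real.rpow_nonneg (abs_nonneg _) _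

theorem jamesSum_rpow {p : ℝ} (hp : 0 < p) (x : ℕ → ℝ) (a : ℕ × {u : ℕ → ℕ // StrictMono u}) :
    jamesSum p x a ^ p = varSum p x a.1 a.2.1 := by
  change (varSum p x a.1 a.2.1 ^ (1 / p)) ^ p = _
  rw [← Real.rpow_mul (varSum_nonneg p x a.1 a.2.1), one_div_mul_cancel hp.ne', Real.rpow_one]

/-- Repetitions may be removed from a monotone sequence of sample points. -/
theorem exists_strictMono_varSum_eq {p : ℝ} (hp : 0 < p) (x : ℕ → ℝ) {w : ℕ → ℕ} (hw : Monotone w)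
    (M : ℕ) : ∃ (M' : ℕ) (u : ℕ → ℕ), StrictMono u ∧ u M' = w M ∧
      varSum p x M' u = varSum p x M w := by
  induction M with
  | zero => exact ⟨0, fun i => w 0 + i, fun a b h => Nat.add_lt_add_left h _, rfl, by simp [varSum]⟩
  | succ M ih =>
    obtain ⟨M', u, hu, huM, hsum⟩ := ih
    rcases (hw (Nat.le_succ M)).eq_or_lt with h | h
    · refine ⟨M', u, hu, huM.trans h, ?_⟩
      rw [hsum]
      unfold varSum
      rw [Finset.sum_range_succ, ← Nat.succ_eq_add_one M, ← h, sub_self, abs_zero,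
        Real.zero_rpow hp.ne', add_zero]
    · let v : ℕ → ℕ := fun i => if i ≤ M' then u i else w (M + 1) + (i - (M' + 1))
      have hv1 : ∀ i ≤ M', v i = u i := fun i hi => if_pos hi
      have hv2 : v (M' + 1) = w (M + 1) := by simp [v]
      refine ⟨M' + 1, v, strictMono_nat_of_lt_succ fun i => ?_, hv2, ?_⟩
      · rcases lt_trichotomy i M' with hi | rfl | hi
        · rw [hv1 i hi.le, hv1 (i + 1) hi]
          exact hu (Nat.lt_succ_self i)
        · rw [hv1 _ le_rfl, hv2, huM]
          exact h
        · simp only [v, if_neg (show ¬ i ≤ M' by omega), if_neg (show ¬ i + 1 ≤ M' by omega)]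
          omega
      · unfold varSum at hsum ⊢
        rw [Finset.sum_range_succ, Finset.sum_range_succ, ← hsum, hv2, hv1 M' le_rfl, huM]
        congr 1
        refine Finset.sum_congr rfl fun i hi => ?_
        have hi := Finset.mem_range.mp hi
        rw [hv1 i hi.le, hv1 (i + 1) hi]

theorem hasFinitePVariation_of_varSum_le {p : ℝ} (hp : 0 < p) {x : ℕ → ℝ} {T : ℝ}
    (h : ∀ M u, StrictMono u → varSum p x M u ≤ T) : HasFinitePVariation p x := by
  refine ⟨T ^ (1 / p), ?_⟩
  rintro _ ⟨a, rfl⟩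
  exact Real.rpow_le_rpow (varSum_nonneg p x a.1 a.2.1) (h a.1 a.2.1 a.2.2)
    (one_div_pos.mpr hp).le

/-- Two families of numbers with at most one nonzero member each. -/
theorem abs_sum_sub_rpow_le {ι : Type*} (s : Finset ι) {a b : ι → ℝ} {p : ℝ} (hp : 0 < p)
    (ha : ∀ i ∈ s, ∀ j ∈ s, i ≠ j → a i = 0 ∨ a j = 0)
    (hb : ∀ i ∈ s, ∀ j ∈ s, i ≠ j → b i = 0 ∨ b j = 0) :
    |∑ i ∈ s, a i - ∑ i ∈ s, b i| ^ p ≤ 2 ^ p * ∑ i ∈ s, |a i - b i| ^ p := by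
  rcases s.eq_empty_or_nonempty with rfl | ⟨i₀, hi₀⟩
  · simp [Real.zero_rpow hp.ne']
  have single : ∀ c : ι → ℝ, (∀ i ∈ s, ∀ j ∈ s, i ≠ j → c i = 0 ∨ c j = 0) →
      ∃ i ∈ s, ∀ j ∈ s, j ≠ i → c j = 0 := by
    intro c hc
    by_cases h : ∃ i ∈ s, c i ≠ 0
    · obtain ⟨i, hi, hci⟩ := h
      exact ⟨i, hi, fun j hj hji => (hc j hj i hi hji).resolve_right hci⟩
    · push Not at h
      exact ⟨i₀, hi₀, fun j hj _ => h j hj⟩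
  obtain ⟨i, hi, hai⟩ := single a ha
  obtain ⟨j, hj, hbj⟩ := single b hb
  rw [Finset.sum_eq_single_of_mem i hi hai, Finset.sum_eq_single_of_mem j hj hbj]
  -- If the nonzero members sit at different indices, the larger one survives alone in its own
  -- difference; hence the factor 2.
  have hle : ∃ k ∈ s, |a i - b j| ≤ 2 * |a k - b k| := by
    by_cases hij : i = j
    · subst hij
      exact ⟨i, hi, by linarith [abs_nonneg (a i - b i)]⟩
    · have h1 := hbj i hi hij
      have h2 := hai j hj (Ne.symm hij)
      have h3 := abs_sub (a i) (b j)
      rcases le_total |a i| |b j| with h | h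
      · refine ⟨j, hj, ?_⟩
        rw [h2, zero_sub, abs_neg]
        linarith
      · refine ⟨i, hi, ?_⟩
        rw [h1, sub_zero]
        linarith
  obtain ⟨k, hk, hle⟩ := hle
  refine (Real.rpow_le_rpow (abs_nonneg _) hle hp.le).trans ?_
  rw [Real.mul_rpow zero_le_two (abs_nonneg _)]
  refine mul_le_mul_of_nonneg_left ?_ (by positivity)
  exact Finset.single_le_sum (f := fun i => |a i - b i| ^ p)
    (fun _ _ => Real.rpow_nonneg (abs_nonneg _) _) hk

namespace JamesSpace

variable {p : ℝ} [hp : Fact (1 < p)]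

theorem exponent_pos : 0 < p := zero_lt_one.trans hp.out

/-- A null sequence of finite `p`-variation as an element of `J_p`. -/
def ofSeq (x : ℕ → ℝ) (h : HasFinitePVariation p x) (h0 : Tendsto x atTop (𝓝 0)) : JamesSpace p :=
  (⟨x, h, h0⟩ : jamesSubmodule p)

theorem seq_ofSeq (x : ℕ → ℝ) (h : HasFinitePVariation p x) (h0 : Tendsto x atTop (𝓝 0)) :
    (ofSeq x h h0).seq = x := rfl

theorem tendsto_seq (x : JamesSpace p) : Tendsto x.seq atTop (𝓝 0) := (Subtype.property x).2

theorem norm_rpow_le {x : JamesSpace p} {T : ℝ}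
    (h : ∀ M u, StrictMono u → varSum p x.seq M u ≤ T) : ‖x‖ ^ p ≤ T := by
  have hp0 : 0 < p := exponent_pos
  have hT : 0 ≤ T := (varSum_nonneg p x.seq 0 id).trans (h 0 id strictMono_id)
  have h1 : ‖x‖ ≤ T ^ (1 / p) := by
    rw [norm_def]
    exact ciSup_le fun a => Real.rpow_le_rpow (varSum_nonneg p x.seq a.1 a.2.1)
      (h a.1 a.2.1 a.2.2) (one_div_pos.mpr hp0).le
  refine (Real.rpow_le_rpow (norm_nonneg x) h1 hp0.le).trans ?_
  rw [← Real.rpow_mul hT, one_div_mul_cancel hp0.ne', Real.rpow_one]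

theorem varSum_le_norm_rpow (x : JamesSpace p) {w : ℕ → ℕ} (hw : Monotone w) (M : ℕ) :
    varSum p x.seq M w ≤ ‖x‖ ^ p := by
  have hp0 : 0 < p := exponent_pos
  obtain ⟨M', u, hu, -, h⟩ := exists_strictMono_varSum_eq hp0 x.seq hw M
  rw [← h]
  have h1 := jamesSum_le_norm x (M', ⟨u, hu⟩)
  have h2 := Real.rpow_le_rpow (jamesSum_nonneg _ _ _) h1 hp0.le
  rwa [jamesSum_rpow hp0] at h2

theorem abs_seq_sub_seq_le (x : JamesSpace p) (m n : ℕ) : |x.seq n - x.seq m| ≤ ‖x‖ := by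
  wlog hmn : m ≤ n generalizing m n
  · rw [abs_sub_comm]
    exact this n m (le_of_not_ge hmn)
  have h := varSum_le_norm_rpow x (w := fun i => if i = 0 then m else n)
    (monotone_nat_of_le_succ fun i => by split_ifs <;> simp_all) 1
  simp only [varSum, Finset.sum_range_one] at h
  exact (Real.rpow_le_rpow_iff (abs_nonneg _) (norm_nonneg _) exponent_pos).mp h

theorem abs_seq_le (x : JamesSpace p) (n : ℕ) : |x.seq n| ≤ ‖x‖ := by
  have h : Tendsto (fun m => |x.seq n - x.seq m|) atTop (𝓝 |x.seq n - 0|) :=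
    (tendsto_const_nhds.sub x.tendsto_seq).abs
  rw [sub_zero] at h
  exact le_of_tendsto h (Eventually.of_forall fun m => x.abs_seq_sub_seq_le m n)

variable (p) in
/-- Evaluation at `n`. -/
noncomputable def eval (n : ℕ) : StrongDual ℝ (JamesSpace p) :=
  LinearMap.mkContinuous
    { toFun := fun x => x.seq n, map_add' := fun _ _ => rfl, map_smul' := fun _ _ => rfl } 1
    fun x => by rw [one_mul]; exact x.abs_seq_le n

theorem eval_apply (n : ℕ) (x : JamesSpace p) : eval p n x = x.seq n := rfl

theorem norm_eval_le (n : ℕ) : ‖eval p n‖ ≤ 1 :=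
  LinearMap.mkContinuous_norm_le _ zero_le_one _

theorem seq_sum {ι : Type*} (s : Finset ι) (z : ι → JamesSpace p) (n : ℕ) :
    (∑ i ∈ s, z i).seq n = ∑ i ∈ s, (z i).seq n := by
  rw [← eval_apply, map_sum]
  rfl

theorem seq_sub (x y : JamesSpace p) (n : ℕ) : (x - y).seq n = x.seq n - y.seq n := by
  rw [← eval_apply, map_sub]
  rfl

/-- Upper `p`-estimate for disjointly supported sequences. -/
theorem norm_sum_rpow_le {ι : Type*} (s : Finset ι) (z : ι → JamesSpace p)
    (h : ∀ i ∈ s, ∀ j ∈ s, i ≠ j → ∀ t, (z i).seq t = 0 ∨ (z j).seq t = 0) :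
    ‖∑ i ∈ s, z i‖ ^ p ≤ 2 ^ p * ∑ i ∈ s, ‖z i‖ ^ p := by
  refine norm_rpow_le fun M u hu => ?_
  unfold varSum
  simp only [seq_sum]
  have hpt : ∀ t ∈ Finset.range M,
      |∑ i ∈ s, (z i).seq (u (t + 1)) - ∑ i ∈ s, (z i).seq (u t)| ^ p
        ≤ 2 ^ p * ∑ i ∈ s, |(z i).seq (u (t + 1)) - (z i).seq (u t)| ^ p := fun t _ =>
    abs_sum_sub_rpow_le s exponent_pos
      (fun i hi j hj hij => h i hi j hj hij _) (fun i hi j hj hij => h i hi j hj hij _)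
  refine (Finset.sum_le_sum hpt).trans ?_
  rw [← Finset.mul_sum, Finset.sum_comm]
  refine mul_le_mul_of_nonneg_left (Finset.sum_le_sum fun i _ => ?_) (by positivity)
  exact (z i).varSum_le_norm_rpow hu.monotone M

theorem varSum_ite_lt_le (n M : ℕ) {u : ℕ → ℕ} (hu : Monotone u) :
    varSum p (fun t => if t < n then 1 else 0) M u ≤ 1 := by
  have hp0 : 0 < p := exponent_pos
  let x : ℕ → ℝ := fun t => if t < n then 1 else 0
  have h1 : ∀ i, |x (u (i + 1)) - x (u i)| ^ p = x (u i) - x (u (i + 1)) := by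
    intro i
    have := hu (show i ≤ i + 1 by omega)
    simp only [x]
    split_ifs
    · simp [Real.zero_rpow hp0.ne']
    · omega
    · simp
    · simp [Real.zero_rpow hp0.ne']
  change ∑ i ∈ Finset.range M, |x (u (i + 1)) - x (u i)| ^ p ≤ 1
  rw [Finset.sum_congr rfl fun i _ => h1 i, Finset.sum_range_sub']
  have h2 : x (u 0) ≤ 1 := by simp only [x]; split_ifs <;> norm_num
  have h3 : 0 ≤ x (u M) := by simp only [x]; split_ifs <;> norm_num
  linarith

variable (p) in
/-- The indicator of `{0, …, n - 1}`. -/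
noncomputable def indicator (n : ℕ) : JamesSpace p :=
  ofSeq (fun t => if t < n then 1 else 0)
    (hasFinitePVariation_of_varSum_le exponent_pos fun M _ hu => varSum_ite_lt_le n M hu.monotone)
    (tendsto_const_nhds.congr' (by
      filter_upwards [eventually_ge_atTop n] with t ht
      rw [if_neg (not_lt.mpr ht)]))

theorem seq_indicator (n t : ℕ) :
    (indicator p n).seq t = if t < n then 1 else 0 := rfl

theorem norm_indicator_le (n : ℕ) : ‖indicator p n‖ ≤ 1 := by
  have h := norm_rpow_le (x := indicator p n) (T := 1)
    fun M u hu => varSum_ite_lt_le n M hu.monotone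
  rw [← Real.one_rpow p] at h
  exact (Real.rpow_le_rpow_iff (norm_nonneg _) zero_le_one exponent_pos).mp h

/-- The sequence `x` stopped outside `[lo, hi]`, and shifted so that it tends to `0`. -/
noncomputable def window (lo hi : ℕ) (x : JamesSpace p) : JamesSpace p :=
  ∑ m ∈ Finset.Ico lo hi, (eval p m - eval p (m + 1)) x • indicator p (m + 1)

theorem seq_window {lo hi : ℕ} (h : lo ≤ hi) (x : JamesSpace p) (t : ℕ) :
    (window lo hi x).seq t = x.seq (min (max t lo) hi) - x.seq hi := by
  induction hi, h using Nat.le_induction with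
  | base =>
    rw [min_eq_right (le_max_right _ _), sub_self]
    simp [window, seq_zero]
  | succ hi h ih =>
    have h1 : window lo (hi + 1) x
        = window lo hi x + (eval p hi - eval p (hi + 1)) x • indicator p (hi + 1) := by
      unfold window
      rw [Finset.sum_Ico_succ_top h]
    rw [h1, seq_add, Pi.add_apply, ih, seq_smul, Pi.smul_apply, seq_indicator, smul_eq_mul]
    change _ + (x.seq hi - x.seq (hi + 1)) * _ = _
    split_ifs with ht
    · rw [min_eq_left (show max t lo ≤ hi by omega), min_eq_left (show max t lo ≤ hi + 1 by omega)]
      ring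
    · rw [min_eq_right (show hi ≤ max t lo by omega),
        min_eq_right (show hi + 1 ≤ max t lo by omega)]
      ring

/-- A window is `x` read at clamped indices, up to a constant. Clamping keeps sample sequences
monotone but creates repetitions, which is why `varSum_le_norm_rpow` allows them. -/
theorem varSum_window {lo hi : ℕ} (h : lo ≤ hi) (x : JamesSpace p) (M : ℕ) (u : ℕ → ℕ) :
    varSum p (window lo hi x).seq M u = varSum p x.seq M fun i => min (max (u i) lo) hi := by
  unfold varSum
  simp only [seq_window h, sub_sub_sub_cancel_right]

theorem norm_window_rpow_le {lo hi : ℕ} (h : lo ≤ hi) (x : JamesSpace p) :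
    ‖window lo hi x‖ ^ p ≤ ‖x‖ ^ p :=
  norm_rpow_le fun M u hu => by
    rw [varSum_window h]
    exact x.varSum_le_norm_rpow
      (fun i j hij => min_le_min_right _ (max_le_max_right _ (hu.monotone hij))) M

/-- Sample sequences for adjacent windows concatenate to one for their union; the increment at the
junction is dropped. -/
theorem norm_window_rpow_add_le {n n' : ℕ} (h : n ≤ n') (x : JamesSpace p) :
    ‖window 0 n x‖ ^ p + ‖window n n' x‖ ^ p ≤ ‖window 0 n' x‖ ^ p := by
  have key : ∀ (M : ℕ) (u : ℕ → ℕ) (M' : ℕ) (v : ℕ → ℕ), StrictMono u → StrictMono v →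
      varSum p (window 0 n x).seq M u + varSum p (window n n' x).seq M' v
        ≤ ‖window 0 n' x‖ ^ p := by
    intro M u M' v hu hv
    rw [varSum_window (Nat.zero_le n), varSum_window h]
    let w : ℕ → ℕ := fun i => if i ≤ M then min (u i) n else min (max (v (i - (M + 1))) n) n'
    have hw : Monotone w := by
      refine monotone_nat_of_le_succ fun i => ?_
      have h1 := hu.monotone (show i ≤ i + 1 by omega)
      have h2 := hv.monotone (show i - (M + 1) ≤ i + 1 - (M + 1) by omega)
      simp only [w]
      split_ifs <;> omega
    have hwn : ∀ i, w i ≤ n' := fun i => by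
      simp only [w]
      split_ifs <;> omega
    refine le_trans ?_ ((window 0 n' x).varSum_le_norm_rpow hw (M + 1 + M'))
    rw [varSum_window (Nat.zero_le n')]
    unfold varSum
    simp only [Nat.max_zero, min_eq_left (hwn _)]
    rw [Finset.sum_range_add]
    refine add_le_add ?_ (le_of_eq (Finset.sum_congr rfl fun i _ => ?_))
    · rw [Finset.sum_range_succ]
      refine le_add_of_le_of_nonneg (le_of_eq (Finset.sum_congr rfl fun i hi => ?_))
        (Real.rpow_nonneg (abs_nonneg _) _)
      have hi := Finset.mem_range.mp hi
      simp only [w, if_pos hi.le, if_pos (Nat.succ_le_of_lt hi)]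
    · have e1 : w (M + 1 + i) = min (max (v i) n) n' := by
        simp only [w, if_neg (show ¬ M + 1 + i ≤ M by omega), Nat.add_sub_cancel_left]
      have e2 : w (M + 1 + i + 1) = min (max (v (i + 1)) n) n' := by
        rw [add_assoc (M + 1)]
        simp only [w, if_neg (show ¬ M + 1 + (i + 1) ≤ M by omega), Nat.add_sub_cancel_left]
      rw [e1, e2]
  rw [← le_sub_iff_add_le]
  refine norm_rpow_le fun M u hu => ?_
  rw [le_sub_iff_add_le, ← le_sub_iff_add_le']
  refine norm_rpow_le fun M' v hv => ?_
  rw [le_sub_iff_add_le']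
  exact key M u M' v hu hv

/-- Lower `p`-estimate with constant `1`. -/
theorem sum_norm_window_rpow_le {lo hi : ℕ → ℕ} (h : ∀ j, lo j ≤ hi j)
    (h' : ∀ j, hi j ≤ lo (j + 1)) (x : JamesSpace p) (M : ℕ) :
    ∑ j ∈ Finset.range M, ‖window (lo j) (hi j) x‖ ^ p ≤ ‖x‖ ^ p := by
  refine le_trans ?_ (norm_window_rpow_le (Nat.zero_le (lo M)) x)
  induction M with
  | zero =>
    rw [Finset.sum_range_zero]
    exact Real.rpow_nonneg (norm_nonneg _) _
  | succ M ih =>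
    rw [Finset.sum_range_succ]
    have h1 := norm_window_rpow_add_le (h M) x
    have h2 := norm_window_rpow_add_le (h' M) x
    have h3 : 0 ≤ ‖window (hi M) (lo (M + 1)) x‖ ^ p := Real.rpow_nonneg (norm_nonneg _) _
    linarith

/-- Finite p-variation passes to the pointwise ultralimit, which therefore converges, though perhaps
not to 0. The constant `c` is its limit; differences of consecutive values do not see it. -/
theorem exists_ultralimit (F : ℕ → JamesSpace p) (R : ℝ) (hF : ∀ i, ‖F i‖ ≤ R) :
    ∃ (x : JamesSpace p) (c : ℝ), ∀ m,
      Tendsto (fun i => (F i).seq m) (hyperfilter ℕ : Filter ℕ) (𝓝 (x.seq m + c)) := by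
  have hp0 : 0 < p := exponent_pos
  have hlim : ∀ m, ∃ y ∈ Set.Icc (-R) R,
      Tendsto (fun i => (F i).seq m) (hyperfilter ℕ : Filter ℕ) (𝓝 y) := fun m => by
    have := (isCompact_Icc (a := -R) (b := R)).ultrafilter_le_nhds
      ((hyperfilter ℕ).map fun i : ℕ => (F i).seq m) (by
        rw [le_principal_iff]
        exact Filter.Eventually.of_forall (p := fun i : ℕ => (F i).seq m ∈ Set.Icc (-R) R)
          fun i => abs_le.mp (((F i).abs_seq_le m).trans (hF i)))
    exact this
  choose y _ hy using hlim
  have hvar : ∀ M u, StrictMono u → varSum p y M u ≤ R ^ p := by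
    intro M u hu
    have h1 : Tendsto (fun i => varSum p (F i).seq M u) (hyperfilter ℕ : Filter ℕ)
        (𝓝 (varSum p y M u)) :=
      tendsto_finsetSum _ fun j _ =>
        (((hy (u (j + 1))).sub (hy (u j))).abs).rpow_const (Or.inr hp0.le)
    refine le_of_tendsto h1 (Eventually.of_forall fun i => ?_)
    exact ((F i).varSum_le_norm_rpow hu.monotone M).trans
      (Real.rpow_le_rpow (norm_nonneg _) (hF i) hp0.le)
  have hc : CauchySeq y := by
    refine cauchySeq_of_sum_dist_rpow_le (B := R ^ p) hp0 fun N hN M => ?_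
    refine le_trans (le_of_eq (Finset.sum_congr rfl fun i _ => ?_)) (hvar M N hN)
    rw [dist_comm, Real.dist_eq]
  obtain ⟨c, hc⟩ := cauchySeq_tendsto_of_complete hc
  refine ⟨ofSeq (fun m => y m - c) (hasFinitePVariation_of_varSum_le (T := R ^ p) hp0
    fun M u hu => ?_) ?_, c, fun m => ?_⟩
  · refine le_trans (le_of_eq ?_) (hvar M u hu)
    simp only [varSum, sub_sub_sub_cancel_right]
  · simpa using hc.sub_const c
  · rw [seq_ofSeq, sub_add_cancel]
    exact hy m

/-- The summing basis of `J_p`. -/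
noncomputable def summingBasis (p : ℝ) [hp : Fact (1 < p)] : JamesBasis (JamesSpace p) p where
  vec n := indicator p (n + 1)
  coord n := eval p n - eval p (n + 1)
  total := eval p 0
  K := 2
  one_le_K := one_le_two
  coord_vec m n := by
    change (indicator p (n + 1)).seq m - (indicator p (n + 1)).seq (m + 1) = _
    simp only [seq_indicator]
    split_ifs <;> first | omega | norm_num
  total_vec n := by
    rw [eval_apply, seq_indicator, if_pos n.succ_pos]
  norm_vec_le n := (norm_indicator_le _).trans one_le_two
  norm_total_le := (norm_eval_le 0).trans one_le_two
  norm_le x R h := by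
    rw [norm_def]
    refine ciSup_le fun a => ?_
    -- Cutting at the last sample point leaves all sampled increments unchanged.
    refine le_trans (le_of_eq ?_) ((jamesSum_le_norm (window 0 (a.2.1 a.1) x) a).trans (h _))
    unfold jamesSum
    congr 1
    refine Finset.sum_congr rfl fun i hi => ?_
    have hi := Finset.mem_range.mp hi
    rw [seq_window (Nat.zero_le _), seq_window (Nat.zero_le _), sub_sub_sub_cancel_right,
      Nat.max_zero, Nat.max_zero, min_eq_left (a.2.2.monotone hi.le),
      min_eq_left (a.2.2.monotone (Nat.succ_le_of_lt hi))]
  exists_limit F R hF := by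
    obtain ⟨x, c, hx⟩ := exists_ultralimit F R hF
    refine ⟨x, fun m => ?_⟩
    have := (hx m).sub (hx (m + 1))
    rw [add_sub_add_right_eq_sub] at this
    exact this
  lower lo hi h h' x M := by
    refine (sum_norm_window_rpow_le h h' x M).trans
      (Real.rpow_le_rpow (norm_nonneg _) ?_ exponent_pos.le)
    linarith [norm_nonneg x]
  upper lo hi h h' z M hz hz0 := by
    have hlo : Monotone lo := monotone_nat_of_le_succ fun j => (h j).trans (h' j)
    -- A block is constant up to `lo j` and zero from `hi j` on. Total zero makes that constant
    -- vanish, so such blocks are disjointly supported.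
    have hsupp : ∀ j < M, ∀ t, (z j).seq t ≠ 0 → lo j < t ∧ t < hi j := by
      intro j hj t ht
      have hzw : ∀ t, (z j).seq t = (z j).seq (min (max t (lo j)) (hi j)) - (z j).seq (hi j) :=
        fun t => by
          rw [← seq_window (h j)]
          exact congrArg (fun y : JamesSpace p => y.seq t) (hz j hj).symm
      have h0 : (z j).seq 0 = 0 := hz0 j hj
      constructor
      · by_contra! hle
        apply ht
        rw [hzw t, max_eq_right hle, ← max_eq_right (Nat.zero_le (lo j)), ← hzw 0, h0]
      · by_contra! hle
        apply ht
        rw [hzw t, min_eq_right (hle.trans (le_max_left _ _)), sub_self]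
    refine norm_sum_rpow_le _ z fun i hi' j hj hij t => ?_
    have hi' := Finset.mem_range.mp hi'
    have hj := Finset.mem_range.mp hj
    by_contra! hne
    obtain ⟨h1, h2⟩ := hsupp i hi' t hne.1
    obtain ⟨h3, h4⟩ := hsupp j hj t hne.2
    rcases lt_or_gt_of_ne hij with hlt | hlt
    · have := (h' i).trans (hlo hlt)
      omega
    · have := (h' j).trans (hlo hlt)
      omega

end JamesSpace

/-! ### The dual space and its basis of evaluations -/

/-- Bounded sequences of functionals have pointwise limits along the hyperfilter. -/
theorem exists_dual_ultralimit {E : Type*} [NormedAddCommGroup E] [NormedSpace ℝ E]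
    (F : ℕ → StrongDual ℝ E) {R : ℝ} (hR : 0 ≤ R) (hF : ∀ i, ‖F i‖ ≤ R) :
    ∃ φ : StrongDual ℝ E, ‖φ‖ ≤ R ∧
      ∀ x, Tendsto (fun i => F i x) (hyperfilter ℕ : Filter ℕ) (𝓝 (φ x)) := by
  have hle : ∀ x i, |F i x| ≤ R * ‖x‖ := fun x i =>
    (F i).le_of_opNorm_le (hF i) x
  have hlim : ∀ x, ∃ y ∈ Set.Icc (-(R * ‖x‖)) (R * ‖x‖),
      Tendsto (fun i => F i x) (hyperfilter ℕ : Filter ℕ) (𝓝 y) := fun x => by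
    have := (isCompact_Icc (a := -(R * ‖x‖)) (b := R * ‖x‖)).ultrafilter_le_nhds
      ((hyperfilter ℕ).map fun i : ℕ => F i x) (by
        rw [le_principal_iff]
        exact Filter.Eventually.of_forall
          (p := fun i : ℕ => F i x ∈ Set.Icc (-(R * ‖x‖)) (R * ‖x‖))
          fun i => abs_le.mp (hle x i))
    exact this
  choose y hyR hy using hlim
  refine ⟨LinearMap.mkContinuous
    { toFun := y
      map_add' := fun a b => tendsto_nhds_unique (hy (a + b))
        (((hy a).add (hy b)).congr fun i => (map_add (F i) a b).symm)
      map_smul' := fun c a => tendsto_nhds_unique (hy (c • a))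
        (((hy a).const_mul c).congr fun i => (map_smul (F i) c a).symm) } R
    fun x => abs_le.mpr (hyR x), LinearMap.mkContinuous_norm_le _ hR _, hy⟩

theorem exists_norm_le_one_half_le {E : Type*} [NormedAddCommGroup E] [NormedSpace ℝ E]
    (φ : StrongDual ℝ E) : ∃ x, ‖x‖ ≤ 1 ∧ ‖φ‖ ≤ 2 * φ x := by
  rcases eq_or_ne φ 0 with rfl | hφ
  · exact ⟨0, by simp, by simp⟩
  · obtain ⟨x, hx, hφx⟩ := φ.exists_lt_apply_of_lt_opNorm (half_lt_self (norm_pos_iff.mpr hφ))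
    rw [Real.norm_eq_abs] at hφx
    rcases le_total 0 (φ x) with h | h
    · rw [abs_of_nonneg h] at hφx
      exact ⟨x, hx.le, by linarith⟩
    · rw [abs_of_nonpos h] at hφx
      exact ⟨-x, by rw [norm_neg]; exact hx.le, by rw [map_neg]; linarith⟩

namespace JamesSpace

variable {p : ℝ} [hp : Fact (1 < p)]

variable (p) in
/-- The unit vectors. -/
noncomputable def single (n : ℕ) : JamesSpace p := indicator p (n + 1) - indicator p n

theorem seq_single (n t : ℕ) : (single p n).seq t = if t = n then 1 else 0 := by
  unfold single
  rw [seq_sub, seq_indicator, seq_indicator]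
  split_ifs <;> first | omega | norm_num

/-- The restriction of a sequence to `[lo, hi)`. -/
noncomputable def trunc (lo hi : ℕ) (x : JamesSpace p) : JamesSpace p :=
  ∑ m ∈ Finset.Ico lo hi, x.seq m • single p m

theorem seq_trunc (lo hi : ℕ) (x : JamesSpace p) (t : ℕ) :
    (trunc lo hi x).seq t = if t ∈ Finset.Ico lo hi then x.seq t else 0 := by
  unfold trunc
  rw [seq_sum]
  simp only [seq_smul, Pi.smul_apply, smul_eq_mul, seq_single, mul_ite, mul_one, mul_zero]
  rw [Finset.sum_ite_eq]

/-- A window is flat rather than zero before `lo`, and lowered by `x.seq hi` on the block; two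
indicator terms correct this, at a bounded cost in norm. -/
theorem trunc_eq {lo hi : ℕ} (h : lo ≤ hi) (x : JamesSpace p) :
    trunc lo hi x = window lo hi x - (x.seq lo - x.seq hi) • indicator p lo
      + x.seq hi • (indicator p hi - indicator p lo) := by
  apply seq_injective
  funext t
  rw [seq_add, Pi.add_apply, seq_sub, seq_smul, seq_smul, Pi.smul_apply, Pi.smul_apply, seq_sub,
    seq_trunc, seq_window h, seq_indicator, seq_indicator, smul_eq_mul, smul_eq_mul]
  rcases lt_or_ge t lo with h1 | h1
  · rw [if_neg (by rw [Finset.mem_Ico]; omega), if_pos h1, if_pos (h1.trans_le h),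
      max_eq_right h1.le, min_eq_left h]
    ring
  · rcases lt_or_ge t hi with h2 | h2
    · rw [if_pos (Finset.mem_Ico.mpr ⟨h1, h2⟩), if_neg (not_lt.mpr h1), if_pos h2,
        max_eq_left h1, min_eq_left h2.le]
      ring
    · rw [if_neg (by rw [Finset.mem_Ico]; omega), if_neg (not_lt.mpr h1), if_neg (not_lt.mpr h2),
        max_eq_left h1, min_eq_right h2]
      ring

theorem norm_window_le {lo hi : ℕ} (h : lo ≤ hi) (x : JamesSpace p) : ‖window lo hi x‖ ≤ ‖x‖ :=
  (Real.rpow_le_rpow_iff (norm_nonneg _) (norm_nonneg _) exponent_pos).mp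
    (norm_window_rpow_le h x)

theorem norm_trunc_le {lo hi : ℕ} (h : lo ≤ hi) (x : JamesSpace p) :
    ‖trunc lo hi x‖ ≤ 5 * ‖x‖ := by
  rw [trunc_eq h]
  have h0 := norm_nonneg x
  have h1 := norm_window_le h x
  have h2 : ‖(x.seq lo - x.seq hi) • indicator p lo‖ ≤ ‖x‖ * 1 := by
    rw [norm_smul, Real.norm_eq_abs]
    exact mul_le_mul (x.abs_seq_sub_seq_le _ _) (norm_indicator_le lo) (norm_nonneg _) h0
  have h3 : ‖x.seq hi • (indicator p hi - indicator p lo)‖ ≤ ‖x‖ * 2 := by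
    rw [norm_smul, Real.norm_eq_abs]
    refine mul_le_mul (x.abs_seq_le _) ((norm_sub_le _ _).trans ?_) (norm_nonneg _) h0
    have := norm_indicator_le (p := p) lo
    have := norm_indicator_le (p := p) hi
    linarith
  refine (norm_add_le _ _).trans ?_
  have := norm_sub_le (window lo hi x) ((x.seq lo - x.seq hi) • indicator p lo)
  linarith

theorem tendsto_trunc (x : JamesSpace p) : Tendsto (fun n => trunc 0 n x) atTop (𝓝 x) := by
  have h1 : Tendsto (fun n => window 0 n x) atTop (𝓝 x) :=
    ((summingBasis p).tendsto_proj exponent_pos x).congr fun n =>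
      (summingBasis p).proj_apply 0 n x
  have h2 : Tendsto (fun n => x.seq n • indicator p n) atTop (𝓝 0) := by
    refine squeeze_zero_norm (a := fun n => |x.seq n|) (fun n => ?_) ?_
    · rw [norm_smul, Real.norm_eq_abs]
      exact mul_le_of_le_one_right (abs_nonneg _) (norm_indicator_le n)
    · simpa using x.tendsto_seq.abs
  have h3 := h1.add h2
  rw [add_zero] at h3
  refine h3.congr fun n => ?_
  have h4 : indicator p 0 = 0 := by
    apply seq_injective
    funext t
    rw [seq_indicator, if_neg (Nat.not_lt_zero t), seq_zero, Pi.zero_apply]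
  rw [trunc_eq (Nat.zero_le n), h4, smul_zero, sub_zero, sub_zero]

/-- The restriction of a functional to sequences supported in `[lo, hi)`. -/
noncomputable def dualTrunc (lo hi : ℕ) (φ : StrongDual ℝ (JamesSpace p)) :
    StrongDual ℝ (JamesSpace p) :=
  ∑ m ∈ Finset.Ico lo hi, φ (single p m) • eval p m

theorem dualTrunc_apply (lo hi : ℕ) (φ : StrongDual ℝ (JamesSpace p)) (x : JamesSpace p) :
    dualTrunc lo hi φ x = φ (trunc lo hi x) := by
  unfold dualTrunc trunc
  rw [map_sum]
  simp only [sum_apply, map_smul, smul_eq_mul]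
  exact Finset.sum_congr rfl fun m _ => mul_comm _ _

/-- Lower estimate in the dual, for the conjugate exponent. -/
theorem sum_norm_dualTrunc_rpow_le {q : ℝ} (hpq : p.HolderConjugate q) {lo hi : ℕ → ℕ}
    (h : ∀ j, lo j ≤ hi j) (h' : ∀ j, hi j ≤ lo (j + 1)) (φ : StrongDual ℝ (JamesSpace p))
    (M : ℕ) :
    ∑ j ∈ Finset.range M, ‖dualTrunc (lo j) (hi j) φ‖ ^ q ≤ (20 * ‖φ‖) ^ q := by
  have hp0 : 0 < p := exponent_pos
  have hq0 : 0 < q := hpq.symm.pos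
  have hlo : Monotone lo := monotone_nat_of_le_succ fun j => (h j).trans (h' j)
  let α : ℕ → ℝ := fun j => ‖dualTrunc (lo j) (hi j) φ‖
  have hα : ∀ j, 0 ≤ α j := fun j => norm_nonneg _
  let S : ℝ := ∑ j ∈ Finset.range M, α j ^ q
  have hS : 0 ≤ S := Finset.sum_nonneg fun j _ => Real.rpow_nonneg (hα j) _
  change S ≤ _
  choose x hx hxα using fun j => exists_norm_le_one_half_le (dualTrunc (lo j) (hi j) φ)
  -- The extremal choice in Hölder's inequality, using almost norming vectors. The upper p-estimate
  -- gives `S ≤ 20 * ‖φ‖ * S ^ (1 / p)`, with 20 = 2 · 2 · 5 from norming, disjoint sums and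
  -- truncation.
  let y : ℕ → JamesSpace p := fun j => α j ^ (q - 1) • trunc (lo j) (hi j) (x j)
  have h1 : S ≤ 2 * φ (∑ j ∈ Finset.range M, y j) := by
    rw [map_sum, Finset.mul_sum]
    refine Finset.sum_le_sum fun j _ => ?_
    rw [map_smul, ← dualTrunc_apply, smul_eq_mul, mul_left_comm]
    rcases (hα j).eq_or_lt with h0 | h0
    · rw [← h0, Real.zero_rpow hq0.ne', Real.zero_rpow hpq.symm.sub_one_ne_zero, zero_mul]
    · calc α j ^ q = α j ^ (q - 1) * α j := by
            rw [← Real.rpow_add_one h0.ne', sub_add_cancel]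
        _ ≤ _ := mul_le_mul_of_nonneg_left (hxα j) (Real.rpow_nonneg (hα j) _)
  have h2 : ‖∑ j ∈ Finset.range M, y j‖ ^ p ≤ (10 * S ^ (1 / p)) ^ p := by
    refine (norm_sum_rpow_le _ y fun i _ j _ hij t => ?_).trans ?_
    · simp only [y, seq_smul, Pi.smul_apply, seq_trunc, smul_eq_mul]
      by_contra! hne
      have hi' := Finset.mem_Ico.mp (of_not_not fun hn => hne.1 (by rw [if_neg hn, mul_zero]))
      have hj' := Finset.mem_Ico.mp (of_not_not fun hn => hne.2 (by rw [if_neg hn, mul_zero]))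
      rcases lt_or_gt_of_ne hij with hlt | hlt
      · have := (h' i).trans (hlo hlt)
        omega
      · have := (h' j).trans (hlo hlt)
        omega
    · rw [Real.mul_rpow (by norm_num) (Real.rpow_nonneg hS _), ← Real.rpow_mul hS,
        one_div_mul_cancel hp0.ne', Real.rpow_one, show (10 : ℝ) = 2 * 5 by norm_num,
        Real.mul_rpow (by norm_num) (by norm_num), mul_assoc]
      refine mul_le_mul_of_nonneg_left ?_ (by positivity)
      rw [Finset.mul_sum]
      refine Finset.sum_le_sum fun j _ => ?_
      have h3 : ‖y j‖ ≤ 5 * α j ^ (q - 1) := by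
        rw [norm_smul, Real.norm_of_nonneg (Real.rpow_nonneg (hα j) _), mul_comm]
        refine mul_le_mul_of_nonneg_right ((norm_trunc_le (h j) _).trans ?_)
          (Real.rpow_nonneg (hα j) _)
        linarith [hx j]
      refine (Real.rpow_le_rpow (norm_nonneg _) h3 hp0.le).trans (le_of_eq ?_)
      rw [Real.mul_rpow (by norm_num) (Real.rpow_nonneg (hα j) _), ← Real.rpow_mul (hα j),
        hpq.symm.sub_one_mul_conj]
  have h4 : ‖∑ j ∈ Finset.range M, y j‖ ≤ 10 * S ^ (1 / p) :=
    (Real.rpow_le_rpow_iff (norm_nonneg _) (by positivity) hp0).mp h2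
  have h5 : S ≤ 20 * ‖φ‖ * S ^ (1 / p) := by
    have h6 := (le_abs_self _).trans (φ.le_opNorm (∑ j ∈ Finset.range M, y j))
    have h7 := mul_le_mul_of_nonneg_left h4 (norm_nonneg φ)
    linarith
  rcases hS.eq_or_lt with h0 | h0
  · rw [← h0]
    positivity
  · have h6 : S ^ (1 / q) ≤ 20 * ‖φ‖ := by
      refine le_of_mul_le_mul_right ?_ (Real.rpow_pos_of_pos h0 (1 / p))
      rw [← Real.rpow_add h0, one_div, one_div, add_comm, hpq.inv_add_inv_eq_one, Real.rpow_one]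
      rwa [one_div] at h5
    have h7 := Real.rpow_le_rpow (Real.rpow_nonneg hS _) h6 hq0.le
    rwa [← Real.rpow_mul hS, one_div_mul_cancel hq0.ne', Real.rpow_one] at h7

/-- Upper estimate in the dual, for blocks that are annihilated by constants. -/
theorem norm_sum_dual_rpow_le {q : ℝ} (hpq : p.HolderConjugate q) {lo hi : ℕ → ℕ}
    (h : ∀ j, lo j ≤ hi j) (h' : ∀ j, hi j ≤ lo (j + 1)) {z : ℕ → StrongDual ℝ (JamesSpace p)}
    {M : ℕ} (hz : ∀ j < M, dualTrunc (lo j) (hi j) (z j) = z j)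
    (hz0 : ∀ j < M, ∑ m ∈ Finset.Ico (lo j) (hi j), z j (single p m) = 0) :
    ‖∑ j ∈ Finset.range M, z j‖ ^ q ≤ ∑ j ∈ Finset.range M, ‖z j‖ ^ q := by
  have hp0 : 0 < p := exponent_pos
  have hq0 : 0 < q := hpq.symm.pos
  let S : ℝ := ∑ j ∈ Finset.range M, ‖z j‖ ^ q
  have hS : 0 ≤ S := Finset.sum_nonneg fun j _ => Real.rpow_nonneg (norm_nonneg _) _
  have h1 : ‖∑ j ∈ Finset.range M, z j‖ ≤ S ^ (1 / q) := by
    refine ContinuousLinearMap.opNorm_le_bound _ (Real.rpow_nonneg hS _) fun x => ?_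
    -- On the block the window differs from `x` by a constant, which `z j` annihilates. Windows,
    -- unlike truncations, satisfy the lower p-estimate with constant 1.
    have hzx : ∀ j < M, z j x = z j (window (lo j) (hi j) x) := by
      intro j hj
      have hev : ∀ x, z j x = ∑ m ∈ Finset.Ico (lo j) (hi j), z j (single p m) * x.seq m := by
        intro x
        conv_lhs => rw [← hz j hj]
        unfold dualTrunc
        simp only [sum_apply]
        rfl
      rw [hev, hev, ← sub_eq_zero, ← Finset.sum_sub_distrib]
      calc _ = ∑ m ∈ Finset.Ico (lo j) (hi j), z j (single p m) * x.seq (hi j) := by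
            refine Finset.sum_congr rfl fun m hm => ?_
            rw [Finset.mem_Ico] at hm
            rw [seq_window (h j), max_eq_left hm.1, min_eq_left hm.2.le]
            ring
        _ = 0 := by rw [← Finset.sum_mul, hz0 j hj, zero_mul]
    rw [sum_apply]
    refine (norm_sum_le_of_le (f := fun j => z j x) _ fun j hj => ?_).trans
      ((Real.inner_le_Lp_mul_Lq (Finset.range M) (fun j => ‖z j‖)
        (fun j => ‖window (lo j) (hi j) x‖) hpq.symm).trans ?_)
    · rw [hzx j (Finset.mem_range.mp hj)]
      exact (z j).le_opNorm _
    · simp only [abs_norm]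
      refine mul_le_mul_of_nonneg_left ?_ (Real.rpow_nonneg hS _)
      have h2 := Real.rpow_le_rpow (Finset.sum_nonneg fun j _ => Real.rpow_nonneg (norm_nonneg _) _)
        (sum_norm_window_rpow_le h h' x M) (one_div_pos.mpr hp0).le
      rwa [← Real.rpow_mul (norm_nonneg x), mul_one_div_cancel hp0.ne', Real.rpow_one] at h2
  have h2 := Real.rpow_le_rpow (norm_nonneg _) h1 hq0.le
  rwa [← Real.rpow_mul hS, one_div_mul_cancel hq0.ne', Real.rpow_one] at h2

/-- There is a functional on `J_p^*` that extends summation of coefficients. -/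
theorem exists_dual_total : ∃ c : StrongDual ℝ (StrongDual ℝ (JamesSpace p)), ‖c‖ ≤ 1 ∧
    ∀ n, c (eval p n) = 1 := by
  obtain ⟨c, hc, hlim⟩ := exists_dual_ultralimit
    (fun i => NormedSpace.inclusionInDoubleDual ℝ (JamesSpace p) (indicator p i)) zero_le_one
    fun i => (NormedSpace.double_dual_bound ℝ _ _).trans (norm_indicator_le i)
  refine ⟨c, hc, fun n => tendsto_nhds_unique (hlim _) (tendsto_const_nhds.congr' ?_)⟩
  filter_upwards [(eventually_gt_atTop n).filter_mono Nat.hyperfilter_le_atTop] with i hi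
  rw [NormedSpace.dual_def, eval_apply, seq_indicator, if_pos hi]

/-- The evaluation functionals as a basis of `J_p^*`. -/
theorem nonempty_jamesBasis_dual {q : ℝ} (hpq : p.HolderConjugate q) :
    Nonempty (JamesBasis (StrongDual ℝ (JamesSpace p)) q) := by
  have hq0 : 0 < q := hpq.symm.pos
  obtain ⟨c, hc, hc1⟩ := exists_dual_total (p := p)
  refine ⟨{
    vec := eval p
    coord := fun n => NormedSpace.inclusionInDoubleDual ℝ (JamesSpace p) (single p n)
    total := c
    K := 20
    one_le_K := by norm_num
    coord_vec := fun m n => ?_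
    total_vec := hc1
    norm_vec_le := fun n => (norm_eval_le n).trans (by norm_num)
    norm_total_le := hc.trans (by norm_num)
    norm_le := fun φ R hR => ?_
    exists_limit := fun F R hF => ?_
    lower := fun lo hi h h' φ M => sum_norm_dualTrunc_rpow_le hpq h h' φ M
    upper := fun lo hi h h' z M hz hz0 => ?_ }⟩
  · simp only [NormedSpace.dual_def, eval_apply, seq_single, eq_comm]
  · have hR0 : 0 ≤ R := (norm_nonneg _).trans (hR 0)
    refine ContinuousLinearMap.opNorm_le_bound _ hR0 fun x => ?_
    refine le_of_tendsto ((φ.continuous.tendsto x).comp (tendsto_trunc x)).norm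
      (Eventually.of_forall fun n => ?_)
    rw [Function.comp_apply, ← dualTrunc_apply]
    exact (dualTrunc 0 n φ).le_of_opNorm_le (hR n) x
  · obtain ⟨φ, -, hφ⟩ := exists_dual_ultralimit F ((norm_nonneg _).trans (hF 0)) hF
    exact ⟨φ, fun m => hφ _⟩
  · refine (norm_sum_dual_rpow_le hpq h h' (M := M) (z := z) hz fun j hj => ?_).trans ?_
    · have h1 := hz0 j hj
      rw [← hz j hj, map_sum] at h1
      simp only [map_smul, hc1, smul_eq_mul, mul_one, NormedSpace.dual_def] at h1
      exact h1
    · refine le_mul_of_one_le_left (Finset.sum_nonneg fun j _ => Real.rpow_nonneg (norm_nonneg _) _)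
        (Real.one_le_rpow (by norm_num) hq0.le)

end JamesSpace

/-! ### Failure of property 𝒬 -/

theorem lipschitzWith_of_interlaced {X : Type*} [NormedAddCommGroup X] {k : ℕ}
    {f : KaltonVertex k → X} {L : ℝ≥0} (h : ∀ n m, Interlaced n m → ‖f n - f m‖ ≤ L) :
    LipschitzWith L f := by
  have hadj : ∀ n m, (kaltonGraph k).Adj n m → dist (f n) (f m) ≤ L := by
    rintro n m ⟨-, hnm | hnm⟩
    · rw [dist_eq_norm]
      exact h _ _ hnm
    · rw [dist_comm, dist_eq_norm]
      exact h _ _ hnm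
  have hwalk : ∀ n m (w : (kaltonGraph k).Walk n m), dist (f n) (f m) ≤ L * w.length := by
    intro n m w
    induction w with
    | nil => simp
    | @cons n n' m hn w ih =>
      rw [SimpleGraph.Walk.length_cons]
      push_cast
      have := dist_triangle (f n) (f n') (f m)
      have := hadj _ _ hn
      linarith
  refine LipschitzWith.of_dist_le_mul fun n m => ?_
  obtain ⟨w, hw⟩ := (kaltonGraph_connected k).exists_walk_length_eq_dist n m
  rw [kalton_dist_def, ← hw]
  exact hwalk n m w

/-- Property `𝒬` fails as soon as there are maps on the interlaced graphs whose oscillation on every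
infinite subset is much larger than their Lipschitz constant. -/
theorem not_propertyQ_of_forall_exists {X : Type*} [NormedAddCommGroup X] (c : ℝ≥0)
    (h : ∀ k : ℕ, ∃ f : KaltonVertex k → X,
      (∀ n m, Interlaced n m → ‖f n - f m‖ ≤ c * √k) ∧
      ∀ n m : KaltonVertex k, (∀ i j, n i < m j) → k ≤ ‖f n - f m‖) : ¬ PropertyQ X := by
  rintro ⟨C, -, hC⟩
  obtain ⟨k, hk⟩ := exists_nat_gt (((C : ℝ) * c) ^ 2)
  have hk0 : (0 : ℝ) < k := lt_of_le_of_lt (by positivity) hk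
  obtain ⟨f, hf, hf'⟩ := h k
  let L : ℝ≥0 := c * NNReal.sqrt k
  have hL : LipschitzWith L f := lipschitzWith_of_interlaced fun n m hnm => by
    simpa [L] using hf n m hnm
  have hω : expansionModulus f 1 ≤ L := by
    refine iSup_le fun n => iSup_le fun m => iSup_le fun hnm => (hL n m).trans ?_
    refine mul_le_of_le_one_right' ?_
    rw [edist_dist]
    exact ENNReal.ofReal_le_one.mpr hnm
  obtain ⟨A, hA, hAf⟩ := hC ⟨k, by exact_mod_cast hk0⟩ f ⟨L, hL⟩
  -- Two disjoint windows in the enumeration of `A` are `k` apart in norm; property 𝒬 would give `k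
  -- ≤ C * c * √k`, against the choice of `k`.
  let s : ℕ → ℕ := Nat.nth (· ∈ A)
  have hs : StrictMono s := Nat.nth_strictMono hA
  have hsA : ∀ i, s i ∈ A := Nat.nth_mem_of_infinite hA
  have h1 := (hAf (kaltonWindow k s hs 0) (kaltonWindow k s hs k) (fun i => hsA _)
    fun i => hsA _).trans (mul_le_mul_right hω C)
  rw [← ENNReal.coe_mul, enorm_eq_nnnorm, ENNReal.coe_le_coe] at h1
  have h2 : ‖f (kaltonWindow k s hs 0) - f (kaltonWindow k s hs k)‖ ≤ C * (c * √k) := by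
    have : (‖f (kaltonWindow k s hs 0) - f (kaltonWindow k s hs k)‖₊ : ℝ) ≤ (C * L : ℝ≥0) := by
      exact_mod_cast h1
    simpa [L] using this
  have h3 := (hf' _ _ fun i j => by
    simp only [kaltonWindow_apply]
    exact hs (by omega)).trans h2
  have h4 := Real.mul_self_sqrt hk0.le
  have h5 : 0 < √(k : ℝ) := Real.sqrt_pos.mpr hk0
  have h6 : √(k : ℝ) ≤ C * c := by
    refine le_of_mul_le_mul_right ?_ h5
    linarith
  have h7 := pow_le_pow_left₀ h5.le h6 2
  rw [Real.sq_sqrt hk0.le] at h7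
  linarith

theorem Interlaced.le_of_lt {k : ℕ} {n m : KaltonVertex k} (h : Interlaced n m) {i j : Fin k}
    (hij : i < j) : m i ≤ n j :=
  (h.2 i ⟨i + 1, by omega⟩ rfl).trans (n.strictMono.monotone (Fin.mk_le_of_le_val hij))

namespace JamesSpace

/-- For interlaced vertices the summands of the difference live on the disjoint intervals `[n i, m
i)`, so the upper 2-estimate gives 2 · 2√k. For separated vertices, the coordinate at the last entry
of `n` has absolute value `k`. -/
theorem not_propertyQ_jamesSpace_two : ¬ PropertyQ (JamesSpace 2) := by
  refine not_propertyQ_of_forall_exists 4 fun k =>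
    ⟨fun v => ∑ i, indicator 2 (v i), fun n m hnm => ?_, fun n m hnm => ?_⟩
  · have h1 : ‖∑ i, (indicator 2 (n i) - indicator 2 (m i))‖ ^ (2 : ℝ) ≤ 2 ^ (2 : ℝ) *
        ∑ i : Fin k, ‖indicator 2 (n i) - indicator 2 (m i)‖ ^ (2 : ℝ) := by
      refine norm_sum_rpow_le _ _ fun i _ j _ hij t => ?_
      rw [seq_sub, seq_sub]
      simp only [seq_indicator]
      have h1 := hnm.1 i
      have h2 := hnm.1 j
      rcases lt_or_gt_of_ne hij with h | h
      · have := hnm.le_of_lt h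
        split_ifs <;> first | omega | norm_num
      · have := hnm.le_of_lt h
        split_ifs <;> first | omega | norm_num
    rw [Finset.sum_sub_distrib] at h1
    have h2 : ∑ i : Fin k, ‖indicator 2 (n i) - indicator 2 (m i)‖ ^ (2 : ℝ) ≤ k * 2 ^ (2 : ℝ) := by
      refine (Finset.sum_le_sum fun i _ => Real.rpow_le_rpow (norm_nonneg _)
        ((norm_sub_le _ _).trans (add_le_add (norm_indicator_le _) (norm_indicator_le _)))
        zero_le_two).trans (le_of_eq ?_)
      rw [Finset.sum_const, Finset.card_univ, Fintype.card_fin, nsmul_eq_mul]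
      norm_num
    simp only [Real.rpow_two] at h1 h2
    refine abs_le_of_sq_le_sq' ?_ (by positivity) |>.2
    have h3 := Real.sq_sqrt (Nat.cast_nonneg k : (0 : ℝ) ≤ k)
    rw [mul_pow, h3]
    push_cast
    linarith
  · cases k with
    | zero => simp
    | succ k =>
      have h1 := abs_seq_le (∑ i, indicator 2 (n i) - ∑ i, indicator 2 (m i)) (n (Fin.last k))
      rw [seq_sub, seq_sum, seq_sum, Finset.sum_eq_zero, Finset.sum_congr rfl fun i _ =>
        (seq_indicator (p := 2) (m i) _).trans (if_pos (hnm _ i))] at h1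
      · rwa [zero_sub, abs_neg, Finset.sum_const, Finset.card_univ, Fintype.card_fin, nsmul_eq_mul,
          mul_one, Nat.abs_cast] at h1
      · intro i _
        rw [seq_indicator, if_neg (not_lt.mpr (n.strictMono.monotone (Fin.le_last i)))]

/-- For interlaced vertices, Cauchy–Schwarz and the lower 2-estimate on the windows from `n i` to `m
i` give √k. For separated vertices, the indicator ending just after the last entry of `n` is a
unit-ball vector on which the difference equals `k`. -/
theorem not_propertyQ_dual_jamesSpace_two : ¬ PropertyQ (StrongDual ℝ (JamesSpace 2)) := by
  refine not_propertyQ_of_forall_exists 1 fun k =>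
    ⟨fun v => ∑ i, eval 2 (v i), fun n m hnm => ?_, fun n m hnm => ?_⟩
  · rw [NNReal.coe_one, one_mul]
    refine ContinuousLinearMap.opNorm_le_bound _ (Real.sqrt_nonneg _) fun x => ?_
    -- The index `∑ i, m i` dominates all entries; it serves to pad the finite families by empty
    -- windows.
    have hmx : ∀ i, n i ≤ ∑ i, m i := fun i => (hnm.1 i).trans
      (Finset.single_le_sum (f := fun i => m i) (fun _ _ => Nat.zero_le _) (Finset.mem_univ i))
    have hmm : ∀ i, m i ≤ ∑ i, m i := fun i =>
      Finset.single_le_sum (f := fun i => m i) (fun _ _ => Nat.zero_le _) (Finset.mem_univ i)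
    have h1 := sum_norm_window_rpow_le
      (lo := fun j => if h : j < k then n ⟨j, h⟩ else ∑ i, m i)
      (hi := fun j => if h : j < k then m ⟨j, h⟩ else ∑ i, m i)
      (fun j => by
        split_ifs with hj
        · exact hnm.1 _
        · exact le_rfl)
      (fun j => by
        split_ifs with hj hj' hj'
        · exact hnm.2 _ _ rfl
        · exact hmm _
        · omega
        · exact le_rfl) x k
    rw [← Fin.sum_univ_eq_sum_range (fun j => ‖window (if h : j < k then n ⟨j, h⟩ else ∑ i, m i)
      (if h : j < k then m ⟨j, h⟩ else ∑ i, m i) x‖ ^ (2 : ℝ))] at h1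
    simp only [Fin.is_lt, dif_pos, Real.rpow_two] at h1
    rw [← Finset.sum_sub_distrib, sum_apply]
    have h2 : ∀ i, |(eval 2 (n i) - eval 2 (m i)) x| ≤ ‖window (n i) (m i) x‖ := by
      intro i
      have h3 := (window (n i) (m i) x).abs_seq_sub_seq_le (m i) (n i)
      rwa [seq_window (hnm.1 i), seq_window (hnm.1 i), max_self, min_eq_left (hnm.1 i),
        min_eq_right (le_max_left _ _), sub_sub_sub_cancel_right] at h3
    refine (Finset.abs_sum_le_sum_abs _ _).trans ((Finset.sum_le_sum fun i _ => h2 i).trans ?_)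
    have h4 := sq_sum_le_card_mul_sum_sq (s := (Finset.univ : Finset (Fin k)))
      (f := fun i => ‖window (n i) (m i) x‖)
    rw [Finset.card_univ, Fintype.card_fin] at h4
    refine abs_le_of_sq_le_sq' ?_ (by positivity) |>.2
    rw [mul_pow, Real.sq_sqrt (Nat.cast_nonneg k)]
    exact h4.trans (mul_le_mul_of_nonneg_left h1 (Nat.cast_nonneg k))
  · cases k with
    | zero => simp
    | succ k =>
      have h1 := (∑ i, eval 2 (n i) - ∑ i, eval 2 (m i)).le_opNorm
        (indicator 2 (n (Fin.last k) + 1))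
      have h2 : (∑ i, eval 2 (n i) - ∑ i, eval 2 (m i)) (indicator 2 (n (Fin.last k) + 1))
          = ((k + 1 : ℕ) : ℝ) := by
        rw [sub_apply, sum_apply, sum_apply,
          Finset.sum_congr rfl fun i _ => (eval_apply (p := 2) (m i) _).trans
            ((seq_indicator (p := 2) _ (m i)).trans
              (if_neg (not_lt.mpr (Nat.succ_le_of_lt (hnm _ i))))),
          Finset.sum_congr rfl fun i _ => (eval_apply (p := 2) (n i) _).trans
            ((seq_indicator (p := 2) _ (n i)).trans
              (if_pos (Nat.lt_succ_of_le (n.strictMono.monotone (Fin.le_last i)))))]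
        simp
      rw [h2, Real.norm_of_nonneg (Nat.cast_nonneg _)] at h1
      exact h1.trans (mul_le_of_le_one_right (norm_nonneg _) (norm_indicator_le _))

end JamesSpace

theorem corollary5p3 :
    (∀ (p : ℝ) [Fact (1 < p)],
      ¬ EquiCoarselyEmbeds (fun k : ℕ+ => KaltonVertex k) (JamesSpace p) ∧
      ¬ EquiCoarselyEmbeds (fun k : ℕ+ => KaltonVertex k) (StrongDual ℝ (JamesSpace p))) ∧
    ¬ PropertyQ (JamesSpace 2) ∧
    ¬ PropertyQ (StrongDual ℝ (JamesSpace 2)) := by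
  refine ⟨fun p hp => ⟨?_, ?_⟩, JamesSpace.not_propertyQ_jamesSpace_two,
    JamesSpace.not_propertyQ_dual_jamesSpace_two⟩
  · exact (JamesSpace.summingBasis p).not_equiCoarselyEmbeds JamesSpace.exponent_pos
  · have hpq := Real.HolderConjugate.conjExponent hp.out
    obtain ⟨B⟩ := JamesSpace.nonempty_jamesBasis_dual hpq
    exact B.not_equiCoarselyEmbeds hpq.symm.pos
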